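/- Let $E$ be a Polish space and let $(X_t,(\mathbb P_x)_{x\in E})_{t\ge 0}$ be a conservative time-homogeneous Markov process on $E$, jointly measurable in $(t,\omega)$, with transition semigroup $P_tf(x)=\mathbb E_x[f(X_t)]$. Let $\mu$ be an invariant probability measure, let $(P_t)$ be strongly continuous on $\mathbb L^2(\mu)$ with infinitesimal generator $L$ and domain $D(L)\subset\mathbb L^2(\mu)$, and write $\langle f,g\rangle_\mu=\int fg\,d\mu$. For a probability measure $\nu$ on $E$ put $\mathbb P_\nu=\int\mathbb P_x\,\nu(dx)$. Let $F$ be a real function on $]0,+\infty[$ that is continuous, strictly increasing and concave, with $F(x)\to+\infty$ as $x\to+\infty$, $F(1)=0$, and $F(xy)\le F(x)+F(y)$ for all $x,y>0$. Let $F(0)\in[-\infty,0[$ be its limit at $0^+$ and let $F^{-1}:\,]F(0),+\infty[\,\to\,]0,+\infty[$ be its inverse; put $F(+\infty)=+\infty$. Assume that $\mu$ satisfies the $F$-Sobolev inequality $$\int f^2F(f^2)\,d\mu\le-\langle Lf,f\rangle_\mu\qquad\text{for all } f\in D(L)\text{ with }\int f^2\,d\mu=1,$$ where the integrand is $0$ wherever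 $f=0$ (the left-hand side being in particular finite), and, for some $C_P>0$, the Poincar\'e inequality $$\mathrm{Var}_\mu(f)\le-C_P\langle Lf,f\rangle_\mu\qquad\text{for all } f\in D(L).$$ Let $V:E\to\mathbb R$ be measurable with $\int V\,d\mu=0$ and $\int V^2\,d\mu=m^2<+\infty$, let $V^+=\max(V,0)$, and assume that $\int F^{-1}(\lambda_0V^+)\,d\mu<+\infty$ for some $\lambda_0>0$. Define $$\lambda_1=\sup\left\{0<\lambda\le\lambda_0\;;\;F\left(\int F^{-1}\left(2\lambda V\,\mathbf 1_{\{\lambda V>1/(4C_P)\}}\right)d\mu\right)\le\frac1{4C_P}\right\},$$ $$I(R)=\sup_{0\le\lambda\le\lambda_1}\left(R\lambda-8m^2C_P\lambda^2\right).$$ Then: 1. $0<\lambda_1\le\lambda_0$. 2. For every probability measure $\nu\ll\mu$ and every $t>0$, the function $s\mapsto V(X_s)$ is $\mathbb P_\nu$-almost surely integrable on $[0,t]$, and for all $R>0$ $$\mathbb P_\nu\left(\frac1t\int_0^tV(X_s)\,ds\ge R\right)\le\left\|\frac{d\nu}{d\mu}\right\|_{\mathbb L^2(\mu)}\exp\left(-t\,I(R)\right),$$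 the right-hand side being $+\infty$ when $d\nu/d\mu\notin\mathbb L^2(\mu)$. 3. The bound is Gaussian for small $R$ and exponential for large $R$: for $R>0$, $I(R)=R^2/(32m^2C_P)$ if $R\le16m^2C_P\lambda_1$, and $I(R)=\lambda_1R-8m^2C_P\lambda_1^2$ if $R\ge16m^2C_P\lambda_1$. -/

import Mathlib

open MeasureTheory ProbabilityTheory Set Filter Topology
open scoped NNReal ENNReal

noncomputable section

/-- A conservative, time-homogeneous, continuous-time Markov process `(X_t, (ℙ_x)_{x ∈ E})` with
state space `E`, realised on a measurable space `Ω` and jointly measurable in time and sample.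
Conservativeness is the fact that `X` takes its values in `E` at all times and that every `ℙ_x` is
a probability measure. -/
structure MarkovProcess (E Ω : Type*) [MeasurableSpace E] [MeasurableSpace Ω] where
  /-- The process `X_t(ω)`. -/
  X : ℝ≥0 → Ω → E
  /-- The laws `ℙ_x` on `Ω`. -/
  law : Kernel E Ω
  measurable_X : Measurable (fun p : ℝ≥0 × Ω => X p.1 p.2)
  isMarkovKernel_law : IsMarkovKernel law
  /-- `X_0 = x` almost surely under `ℙ_x`. -/
  start : ∀ x, ∀ᵐ ω ∂(law x), X 0 ω = x
  /-- The Markov property with respect to the natural filtration `σ(X_r, r ≤ s)`: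
  `ℙ_x(B, X_{s+t} ∈ A) = 𝔼_x[1_B ℙ_{X_s}(X_t ∈ A)]`. -/
  markov : ∀ (x : E) (s t : ℝ≥0) (B : Set Ω) (A : Set E),
    MeasurableSet[⨆ r : Set.Iic s, MeasurableSpace.comap (X r) inferInstance] B →
    MeasurableSet A →
      law x (B ∩ X (s + t) ⁻¹' A) = ∫⁻ ω in B, law (X s ω) (X t ⁻¹' A) ∂(law x)

namespace MarkovProcess

variable {E Ω : Type*} [MeasurableSpace E] [MeasurableSpace Ω]

/-- The law `ℙ_ν = ∫ ℙ_x ν(dx)` of the process with initial distribution `ν`. -/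
def lawFrom (M : MarkovProcess E Ω) (ν : Measure E) : Measure Ω := ν.bind M.law

/-- The transition kernel `P_t(x, A) = ℙ_x(X_t ∈ A)`. -/
def transition (M : MarkovProcess E Ω) (t : ℝ≥0) : Kernel E E := M.law.map (M.X t)

/-- The semigroup `P_t f(x) = 𝔼_x[f(X_t)]`. -/
def semigroup (M : MarkovProcess E Ω) (t : ℝ≥0) (f : E → ℝ) (x : E) : ℝ :=
  ∫ y, f y ∂(M.transition t x)

/-- `μ` is invariant: `μ P_t = μ` for all `t`. -/
def IsInvariant (M : MarkovProcess E Ω) (μ : Measure E) : Prop :=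
  ∀ t, Kernel.Invariant (M.transition t) μ

/-- The semigroup is strongly continuous on `L²(μ)`. -/
def IsStronglyContinuous (M : MarkovProcess E Ω) (μ : Measure E) : Prop :=
  ∀ f : E → ℝ, MemLp f 2 μ →
    Tendsto (fun t : ℝ≥0 => eLpNorm (fun x => M.semigroup t f x - f x) 2 μ) (𝓝[>] 0) (𝓝 0)

/-- The graph of the infinitesimal generator `L` of the semigroup on `L²(μ)`: `f ∈ D(L)` and
`L f = g`, that is, `(P_t f - f) / t → g` in `L²(μ)` as `t ↓ 0`. -/
def GeneratorGraph (M : MarkovProcess E Ω) (μ : Measure E) (f g : E → ℝ) : Prop :=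
  MemLp f 2 μ ∧ MemLp g 2 μ ∧
    Tendsto (fun t : ℝ≥0 =>
      eLpNorm (fun x => (t : ℝ)⁻¹ * (M.semigroup t f x - f x) - g x) 2 μ) (𝓝[>] 0) (𝓝 0)

/-- The Poincaré inequality `Var_μ(f) ≤ - C ⟨L f, f⟩_μ` for all `f ∈ D(L)`. -/
def Poincare (M : MarkovProcess E Ω) (μ : Measure E) (C : ℝ) : Prop :=
  ∀ f g : E → ℝ, M.GeneratorGraph μ f g → variance f μ ≤ - C * ∫ x, g x * f x ∂μ

/-- The `F`-Sobolev inequality `∫ f² F(f²) dμ ≤ - ⟨L f, f⟩_μ` for all `f ∈ D(L)` with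
`∫ f² dμ = 1`; at points where `f = 0` the integrand is `0`. The integral on the left is
required to converge. -/
def FSobolev (M : MarkovProcess E Ω) (μ : Measure E) (F : ℝ → ℝ) : Prop :=
  ∀ f g : E → ℝ, M.GeneratorGraph μ f g → ∫ x, f x ^ 2 ∂μ = 1 →
    Integrable (fun x => f x ^ 2 * F (f x ^ 2)) μ ∧
      ∫ x, f x ^ 2 * F (f x ^ 2) ∂μ ≤ - ∫ x, g x * f x ∂μ

end MarkovProcess

/-- The standing assumptions on `F`. Only the values on `]0, +∞[` matter, and `F(0)` is understood
as the limit at `0+`, which may be `-∞` (as for `F = log`). -/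
structure IsSobolevFunction (F : ℝ → ℝ) : Prop where
  continuousOn : ContinuousOn F (Ioi 0)
  strictMonoOn : StrictMonoOn F (Ioi 0)
  concaveOn : ConcaveOn ℝ (Ioi 0) F
  tendsto_atTop : Tendsto F atTop atTop
  map_one : F 1 = 0
  map_mul_le : ∀ x y : ℝ, 0 < x → 0 < y → F (x * y) ≤ F x + F y

/-- The inverse function `F⁻¹ : ]F(0), +∞[ → ]0, +∞[` of `F`. -/
def sobolevInv (F : ℝ → ℝ) : ℝ → ℝ := Function.invFunOn F (Ioi 0)

/-- The function `2 l V 1_{l V > 1 / (4 C)}`. -/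
def truncatedPotential {E : Type*} (V : E → ℝ) (C l : ℝ) : E → ℝ :=
  {x | 1 / (4 * C) < l * V x}.indicator (fun x => 2 * l * V x)

/-- `λ₁ = sup {0 < l ≤ l₀ : F(∫ F⁻¹(2 l V 1_{l V > 1 / (4 C)}) dμ) ≤ 1 / (4 C)}`, where
`F(+∞) = +∞`, so that the integral has to be finite. -/
def lambdaOne {E : Type*} [MeasurableSpace E] (μ : Measure E) (F : ℝ → ℝ) (V : E → ℝ)
    (C l₀ : ℝ) : ℝ :=
  sSup {l : ℝ | 0 < l ∧ l ≤ l₀ ∧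
    Integrable (fun x => sobolevInv F (truncatedPotential V C l x)) μ ∧
    F (∫ x, sobolevInv F (truncatedPotential V C l x) ∂μ) ≤ 1 / (4 * C)}

/-- `sup_{0 ≤ l ≤ l₁} (R l - 8 m² C l²)`. -/
def deviationRate (m C l₁ R : ℝ) : ℝ :=
  sSup ((fun l : ℝ => R * l - 8 * m ^ 2 * C * l ^ 2) '' Icc 0 l₁)

end

/-! ### Powers and exponentials of integrals in `[0, ∞]` -/

noncomputable section

/-! Write `u_t(x) = 𝔼_x[exp(l ∫_0^t V(X_s) ds)]` and `C = C_P`. Chebyshev's inequality, followed by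
Cauchy-Schwarz in `L²(μ)`, bounds the deviation probability by `exp(-lRt) ‖dν/dμ‖ ‖u_t‖`. Formally
`∂_t u = (L + lV) u`, hence `d/dt ‖u‖² = 2 ⟨(L + lV) u, u⟩`. Everything therefore rests on the form
bound `⟨(L + lV) f, f⟩ ≤ 8 C l² m² ‖f‖²` for `0 < l < λ₁`; optimising over `l` gives the rate. Only
the quadratic form of `L` enters, so no symmetry is needed.

For the form bound (`form_le`), split `f = a + h` with `a = ∫ f dμ` and let `e = -⟨Lf, f⟩`, which is
also the energy of `h`. The term `a² ∫ V` vanishes. For `∫ l V h²`, use `l V⁺ ≤ 1/(4C) + U/2`, where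
`U` is the truncated potential. Concavity and subadditivity of `F` turn the `F`-Sobolev inequality
into an entropic inequality for `U` (`integral_mul_sq_le`), and the definition of `λ₁` together with
Poincaré leaves at most `3e/8 + e/2 = 7e/8`. The cross term `2a ∫ l V h` is split by Cauchy-Schwarz,
Poincaré and the arithmetic-geometric mean inequality into `8 C l² m² a² + e/8`, which uses up the
remaining energy.

Three points make the formal argument rigorous. First, `V` is truncated to a bounded potential and
shifted to be nonnegative; Fatou's lemma removes the truncation. Second, `u_t` need not lie in
`D(L)`, but its averages over `[t, t + ε]` do, and they satisfy the evolution equation exactly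
(`generatorGraph_feynmanKacAverage`); the energy estimate is run on them before `ε → 0`. Third, the
Markov property is assumed for a single future time, and it is extended to `exp ∫ W(X_{s+r}) dr` by
expanding the exponential and writing powers of the integral as integrals over tuples of times. -/

theorem lintegral_fin_prod_eq_pow {α : Type*} [MeasurableSpace α] (ρ : Measure α) [SigmaFinite ρ]
    {f : α → ℝ≥0∞} (hf : Measurable f) (n : ℕ) :
    ∫⁻ σ : Fin n → α, ∏ i, f (σ i) ∂(Measure.pi fun _ => ρ) = (∫⁻ a, f a ∂ρ) ^ n := by
  induction n with
  | zero => simp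
  | succ n ih =>
    rw [← ((measurePreserving_piFinSuccAbove (fun _ : Fin (n + 1) => ρ) 0).symm).lintegral_comp_emb
      (MeasurableEquiv.measurableEmbedding _)]
    simp_rw [MeasurableEquiv.piFinSuccAbove_symm_apply, Fin.insertNthEquiv, Fin.prod_univ_succ,
      Fin.insertNth_zero, Equiv.coe_fn_mk, Fin.cons_succ, Fin.cons_zero]
    rw [pow_succ', ← ih]
    exact lintegral_prod_mul hf.aemeasurable
      (Finset.measurable_fun_prod _ fun i _ => hf.comp (measurable_pi_apply i)).aemeasurable

theorem lintegral_tsum_mul_const {α : Type*} [MeasurableSpace α] {ρ : Measure α}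
    {f : ℕ → α → ℝ≥0∞} (hf : ∀ n, Measurable (f n)) (c : ℕ → ℝ≥0∞) :
    ∫⁻ a, ∑' n, f n a * c n ∂ρ = ∑' n, (∫⁻ a, f n a ∂ρ) * c n := by
  rw [lintegral_tsum fun n => ((hf n).mul_const _).aemeasurable]
  exact tsum_congr fun n => lintegral_mul_const _ (hf n)

/-- The exponential series in `[0, ∞]`. -/
def expSeries (a : ℝ≥0∞) : ℝ≥0∞ := ∑' n : ℕ, a ^ n * (n.factorial : ℝ≥0∞)⁻¹

theorem expSeries_ofReal {a : ℝ} (ha : 0 ≤ a) :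
    expSeries (ENNReal.ofReal a) = ENNReal.ofReal (Real.exp a) := by
  have h : Real.exp a = ∑' n : ℕ, a ^ n / n.factorial := by
    rw [Real.exp_eq_exp_ℝ, NormedSpace.exp_eq_tsum_div]
  rw [h, ENNReal.ofReal_tsum_of_nonneg (fun n => by positivity) (Real.summable_pow_div_factorial a),
    expSeries]
  refine tsum_congr fun n => ?_
  rw [ENNReal.ofReal_div_of_pos (by positivity), ENNReal.ofReal_pow ha, ENNReal.ofReal_natCast,
    div_eq_mul_inv]

/-! ### The Markov property for exponentials of path integrals -/

namespace MarkovProcess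

variable {E Ω : Type*} [MeasurableSpace E] [MeasurableSpace Ω] (M : MarkovProcess E Ω)

instance : IsMarkovKernel M.law := M.isMarkovKernel_law

theorem measurable_at (t : ℝ≥0) : Measurable (M.X t) :=
  M.measurable_X.comp measurable_prodMk_left

instance (t : ℝ≥0) : IsMarkovKernel (M.transition t) :=
  Kernel.IsMarkovKernel.map _ (M.measurable_at t)

theorem transition_apply (t : ℝ≥0) (x : E) : M.transition t x = (M.law x).map (M.X t) :=
  Kernel.map_apply _ (M.measurable_at t) x

theorem lintegral_transition (t : ℝ≥0) (x : E) {f : E → ℝ≥0∞} (hf : Measurable f) :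
    ∫⁻ y, f y ∂M.transition t x = ∫⁻ ω, f (M.X t ω) ∂M.law x := by
  rw [transition_apply, lintegral_map hf (M.measurable_at t)]

/-- The natural filtration `σ(X_r, r ≤ s)`. -/
@[reducible] def past (s : ℝ≥0) : MeasurableSpace Ω :=
  ⨆ r : Set.Iic s, MeasurableSpace.comap (M.X r) inferInstance

theorem past_le (s : ℝ≥0) : M.past s ≤ ‹MeasurableSpace Ω› :=
  iSup_le fun r => (M.measurable_at r).comap_le

theorem measurable_past {r s : ℝ≥0} (h : r ≤ s) : Measurable[M.past s] (M.X r) :=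
  Measurable.mono (comap_measurable _)
    (le_iSup (fun r : Set.Iic s => MeasurableSpace.comap (M.X r) inferInstance) ⟨r, h⟩) le_rfl

/-- The Markov property for sets `A` is an equality of two measures on `E`, so it can be integrated
against any `f`. -/
theorem setLIntegral_markov (x : E) (s t : ℝ≥0) {B : Set Ω} (hB : MeasurableSet[M.past s] B)
    {f : E → ℝ≥0∞} (hf : Measurable f) :
    ∫⁻ ω in B, f (M.X (s + t) ω) ∂M.law x =
      ∫⁻ ω in B, ∫⁻ y, f y ∂M.transition t (M.X s ω) ∂M.law x := by
  have key : ((M.law x).restrict B).map (M.X (s + t)) =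
      (((M.law x).restrict B).map (M.X s)).bind (M.transition t) := by
    ext A hA
    rw [Measure.map_apply (M.measurable_at _) hA,
      Measure.restrict_apply (M.measurable_at _ hA), Measure.bind_apply hA
      (M.transition t).measurable.aemeasurable, lintegral_map
      ((M.transition t).measurable_coe hA) (M.measurable_at s), inter_comm,
      M.markov x s t B A hB hA]
    refine lintegral_congr fun ω => ?_
    rw [transition_apply, Measure.map_apply (M.measurable_at _) hA]
  rw [← lintegral_map hf (M.measurable_at _), key,
    Measure.lintegral_bind (M.transition t).measurable.aemeasurable hf.aemeasurable,
    lintegral_map hf.lintegral_kernel (M.measurable_at s)]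

/-- The two sides, with `G` replaced by the indicator of a past event, are measures on `Ω` with
different densities. They agree once trimmed to the past σ-algebra, and hence integrate every
past-measurable `G` equally. -/
theorem lintegral_mul_markov (x : E) (s t : ℝ≥0) {G : Ω → ℝ≥0∞} (hG : Measurable[M.past s] G)
    {f : E → ℝ≥0∞} (hf : Measurable f) :
    ∫⁻ ω, G ω * f (M.X (s + t) ω) ∂M.law x =
      ∫⁻ ω, G ω * ∫⁻ y, f y ∂M.transition t (M.X s ω) ∂M.law x := by
  have hG' : Measurable G := hG.mono (M.past_le s) le_rfl
  have h1 : Measurable fun ω => f (M.X (s + t) ω) := hf.comp (M.measurable_at _)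
  have h2 : Measurable fun ω => ∫⁻ y, f y ∂M.transition t (M.X s ω) :=
    hf.lintegral_kernel.comp (M.measurable_at s)
  have key : ((M.law x).withDensity fun ω => f (M.X (s + t) ω)).trim (M.past_le s) =
      ((M.law x).withDensity fun ω => ∫⁻ y, f y ∂M.transition t (M.X s ω)).trim
        (M.past_le s) := by
    refine @Measure.ext _ (M.past s) _ _ fun B hB => ?_
    rw [trim_measurableSet_eq _ hB, trim_measurableSet_eq _ hB,
      withDensity_apply _ (M.past_le s _ hB), withDensity_apply _ (M.past_le s _ hB),
      M.setLIntegral_markov x s t hB hf]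
  have h := lintegral_trim (μ := (M.law x).withDensity fun ω => f (M.X (s + t) ω))
    (M.past_le s) hG
  rw [key, lintegral_trim (M.past_le s) hG, lintegral_withDensity_eq_lintegral_mul _ h1 hG',
    lintegral_withDensity_eq_lintegral_mul _ h2 hG'] at h
  simp only [Pi.mul_apply] at h
  simp_rw [mul_comm (G _)]
  exact h.symm

/-- The finite-dimensional distributions of the process restarted at time `s`. -/
theorem lintegral_finset_prod_shift (x : E) (s : ℝ≥0) (J : Finset ℝ≥0) :
    ∀ {g : E → ℝ≥0∞} {f : ℝ≥0 → E → ℝ≥0∞}, Measurable g → (∀ i, Measurable (f i)) →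
    ∫⁻ ω, g (M.X s ω) * ∏ i ∈ J, f i (M.X (s + i) ω) ∂M.law x =
      ∫⁻ y, g y * ∫⁻ ω, ∏ i ∈ J, f i (M.X i ω) ∂M.law y ∂M.transition s x := by
  induction J using Finset.induction_on_max with
  | empty => intro g f hg hf; simp [M.lintegral_transition s x hg]
  | insert r J hr ih =>
    intro g f hg hf
    have hrJ : r ∉ J := fun h => lt_irrefl _ (hr r h)
    simp_rw [Finset.prod_insert hrJ]
    rcases J.eq_empty_or_nonempty with rfl | hJ
    · simp only [Finset.prod_empty, mul_one]
      rw [M.lintegral_mul_markov x s r (G := fun ω => g (M.X s ω))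
        (hg.comp (M.measurable_past le_rfl)) (hf r)]
      simp_rw [← M.lintegral_transition r _ (hf r)]
      have hm : Measurable fun y => g y * ∫⁻ z, f r z ∂M.transition r y :=
        hg.mul (hf r).lintegral_kernel
      rw [M.lintegral_transition s x hm]
    -- Condition on the past up to `q`, the last time before `r`. The factor at time `r` becomes
    -- `P_{r-q} (f r)` evaluated at `X_q` and is absorbed into the factor at `q`. This changes the
    -- functions, which is why the induction quantifies over `f`.
    · obtain ⟨q, hq⟩ : ∃ q, q = J.max' hJ := ⟨_, rfl⟩
      have hqJ : q ∈ J := hq ▸ J.max'_mem hJ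
      have hle : ∀ i ∈ J, i ≤ q := fun i hi => hq ▸ J.le_max' i hi
      have hqr : q + (r - q) = r := add_tsub_cancel_of_le (hr q hqJ).le
      have hP : Measurable fun z => ∫⁻ y, f r y ∂M.transition (r - q) z :=
        (hf r).lintegral_kernel
      obtain ⟨f', hf'⟩ : ∃ f' : ℝ≥0 → E → ℝ≥0∞, f' = fun i y =>
          f i y * if i = q then ∫⁻ z, f r z ∂M.transition (r - q) y else 1 := ⟨_, rfl⟩
      have hf'm : ∀ i, Measurable (f' i) := by
        intro i
        rw [hf']
        refine (hf i).mul ?_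
        split_ifs
        · exact hP
        · exact measurable_const
      have hprod : ∀ Y : ℝ≥0 → E, ∏ i ∈ J, f' i (Y i) =
          (∏ i ∈ J, f i (Y i)) * ∫⁻ z, f r z ∂M.transition (r - q) (Y q) := by
        intro Y
        rw [hf', Finset.prod_mul_distrib, Finset.prod_ite_eq_of_mem' _ _ _ hqJ]
      -- Needed twice: for the shifted process (`a = s`) and for the process restarted at `y` (`a =
      -- 0`).
      have hfirst : ∀ z (a : ℝ≥0) (k : E → ℝ≥0∞), Measurable k →
          ∫⁻ ω, k (M.X a ω) * (f r (M.X (a + r) ω) * ∏ i ∈ J, f i (M.X (a + i) ω)) ∂M.law z =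
          ∫⁻ ω, k (M.X a ω) * ∏ i ∈ J, f' i (M.X (a + i) ω) ∂M.law z := by
        intro z a k hk
        have hG : Measurable[M.past (a + q)] fun ω =>
            k (M.X a ω) * ∏ i ∈ J, f i (M.X (a + i) ω) :=
          Measurable.mul (hk.comp (M.measurable_past le_self_add))
            (Finset.measurable_fun_prod _ fun i hi =>
              (hf i).comp (M.measurable_past (by gcongr; exact hle i hi)))
        have h := M.lintegral_mul_markov z (a + q) (r - q) hG (hf r)
        rw [add_assoc, hqr] at h
        simp_rw [fun ω => hprod fun i => M.X (a + i) ω, ← mul_assoc] at *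
        rw [← h]
        refine lintegral_congr fun ω => ?_
        ring
      rw [hfirst x s g hg, ih hg hf'm]
      refine lintegral_congr fun y => ?_
      have h := hfirst y 0 1 measurable_one
      simp only [zero_add, Pi.one_apply, one_mul] at h
      rw [h]

/-- A tuple of times may be unordered and have repetitions. Grouping equal times, with `W` raised to
the size of the fibre, reduces it to a finite set. -/
theorem lintegral_fin_prod_shift (x : E) (s : ℝ≥0) {g W : E → ℝ≥0∞} (hg : Measurable g)
    (hW : Measurable W) {n : ℕ} (σ : Fin n → ℝ≥0) :
    ∫⁻ ω, g (M.X s ω) * ∏ i, W (M.X (s + σ i) ω) ∂M.law x =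
      ∫⁻ y, g y * ∫⁻ ω, ∏ i, W (M.X (σ i) ω) ∂M.law y ∂M.transition s x := by
  classical
  have h := M.lintegral_finset_prod_shift x s (Finset.univ.image σ) (g := g)
    (f := fun b y => W y ^ (Finset.univ.filter fun a => σ a = b).card) hg
    fun i => hW.pow_const _
  simp_rw [fun ω => Finset.prod_comp (s := Finset.univ) (fun b => W (M.X (s + b) ω)) σ,
    fun ω => Finset.prod_comp (s := Finset.univ) (fun b => W (M.X b ω)) σ]
  exact h

theorem measurable_shift (s : ℝ≥0) : Measurable fun p : ℝ≥0 × Ω => M.X (s + p.1) p.2 :=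
  M.measurable_X.comp ((measurable_const.add measurable_fst).prodMk measurable_snd)

theorem measurable_lintegral_path (ρ : Measure ℝ≥0) [SigmaFinite ρ] (s : ℝ≥0) {W : E → ℝ≥0∞}
    (hW : Measurable W) : Measurable fun ω => ∫⁻ r, W (M.X (s + r) ω) ∂ρ :=
  (hW.comp (M.measurable_shift s)).lintegral_prod_left'

/-- By Tonelli the `n`-th power of a time integral is an integral over `n`-tuples of times of
products, to which the finite-dimensional identity applies. Working in `[0, ∞]` dispenses with
integrability. -/
theorem lintegral_pow_shift (ρ : Measure ℝ≥0) [SigmaFinite ρ] (x : E) (s : ℝ≥0)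
    {g W : E → ℝ≥0∞} (hg : Measurable g) (hW : Measurable W) (n : ℕ) :
    ∫⁻ ω, g (M.X s ω) * (∫⁻ r, W (M.X (s + r) ω) ∂ρ) ^ n ∂M.law x =
      ∫⁻ y, g y * ∫⁻ ω, (∫⁻ r, W (M.X r ω) ∂ρ) ^ n ∂M.law y ∂M.transition s x := by
  have hmeas : ∀ a : ℝ≥0, Measurable fun p : Ω × (Fin n → ℝ≥0) =>
      ∏ i, W (M.X (a + p.2 i) p.1) := fun a =>
    Finset.measurable_fun_prod _ fun i _ => by
      have h : Measurable fun p : Ω × (Fin n → ℝ≥0) => (p.2 i, p.1) := by fun_prop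
      exact hW.comp ((M.measurable_shift a).comp h)
  have hpow : ∀ a ω, (∫⁻ r, W (M.X (a + r) ω) ∂ρ) ^ n =
      ∫⁻ σ : Fin n → ℝ≥0, ∏ i, W (M.X (a + σ i) ω) ∂(Measure.pi fun _ => ρ) := by
    intro a ω
    have := lintegral_fin_prod_eq_pow ρ (f := fun r => W (M.X (a + r) ω))
      (hW.comp ((M.measurable_shift a).comp measurable_prodMk_right)) n
    exact this.symm
  have hpow0 := hpow 0
  have hmeas0 := hmeas 0
  simp only [zero_add] at hpow0 hmeas0
  simp_rw [hpow, hpow0]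
  have hk : Measurable fun p : E × (Fin n → ℝ≥0) => ∫⁻ ω, ∏ i, W (M.X (p.2 i) ω) ∂M.law p.1 := by
    have := Measurable.lintegral_kernel_prod_right' (κ := M.law.comap
      (Prod.fst : E × (Fin n → ℝ≥0) → E) measurable_fst)
      (f := fun q : (E × (Fin n → ℝ≥0)) × Ω => ∏ i, W (M.X (q.1.2 i) q.2))
      (hmeas0.comp (measurable_snd.prodMk (measurable_snd.comp measurable_fst)))
    simpa [Kernel.comap_apply] using this
  calc _ = ∫⁻ ω, ∫⁻ σ : Fin n → ℝ≥0, g (M.X s ω) * ∏ i, W (M.X (s + σ i) ω)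
        ∂(Measure.pi fun _ => ρ) ∂M.law x := by
        refine lintegral_congr fun ω => ?_
        rw [lintegral_const_mul]
        exact (hmeas s).comp measurable_prodMk_left
    _ = ∫⁻ σ : Fin n → ℝ≥0, ∫⁻ ω, g (M.X s ω) * ∏ i, W (M.X (s + σ i) ω)
        ∂M.law x ∂(Measure.pi fun _ => ρ) :=
        lintegral_lintegral_swap
          (((hg.comp (M.measurable_at s)).comp measurable_fst).mul (hmeas s)).aemeasurable
    _ = ∫⁻ σ : Fin n → ℝ≥0, ∫⁻ y, g y * ∫⁻ ω, ∏ i, W (M.X (σ i) ω) ∂M.law y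
        ∂M.transition s x ∂(Measure.pi fun _ => ρ) := by
        simp_rw [M.lintegral_fin_prod_shift x s hg hW]
    _ = ∫⁻ y, ∫⁻ σ : Fin n → ℝ≥0, g y * ∫⁻ ω, ∏ i, W (M.X (σ i) ω) ∂M.law y
        ∂(Measure.pi fun _ => ρ) ∂M.transition s x := by
        refine lintegral_lintegral_swap (Measurable.aemeasurable ?_)
        exact (hg.comp measurable_snd).mul (hk.comp measurable_swap)
    _ = _ := by
        refine lintegral_congr fun y => ?_
        have hky : Measurable fun σ : Fin n → ℝ≥0 => ∫⁻ ω, ∏ i, W (M.X (σ i) ω) ∂M.law y :=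
          hk.comp measurable_prodMk_left
        rw [lintegral_const_mul _ hky]
        congr 1
        exact lintegral_lintegral_swap (hmeas0.comp measurable_swap).aemeasurable

theorem lintegral_expSeries_shift (ρ : Measure ℝ≥0) [SigmaFinite ρ] (x : E) (s : ℝ≥0)
    {g W : E → ℝ≥0∞} (hg : Measurable g) (hW : Measurable W) :
    ∫⁻ ω, g (M.X s ω) * expSeries (∫⁻ r, W (M.X (s + r) ω) ∂ρ) ∂M.law x =
      ∫⁻ y, g y * ∫⁻ ω, expSeries (∫⁻ r, W (M.X r ω) ∂ρ) ∂M.law y ∂M.transition s x := by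
  have hA := M.measurable_lintegral_path ρ s hW
  have hA0 := M.measurable_lintegral_path ρ 0 hW
  simp only [zero_add] at hA0
  have hgX : Measurable fun ω => g (M.X s ω) := hg.comp (M.measurable_at s)
  have hA0k : ∀ n : ℕ, Measurable fun y => ∫⁻ ω, (∫⁻ r, W (M.X r ω) ∂ρ) ^ n ∂M.law y :=
    fun n => (hA0.pow_const n).lintegral_kernel
  have hsum : ∀ y, ∫⁻ ω, expSeries (∫⁻ r, W (M.X r ω) ∂ρ) ∂M.law y =
      ∑' n : ℕ, (∫⁻ ω, (∫⁻ r, W (M.X r ω) ∂ρ) ^ n ∂M.law y) * (n.factorial : ℝ≥0∞)⁻¹ := by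
    intro y
    simp_rw [expSeries]
    exact lintegral_tsum_mul_const (fun n => hA0.pow_const n) _
  calc _ = ∫⁻ ω, ∑' n : ℕ, (g (M.X s ω) * (∫⁻ r, W (M.X (s + r) ω) ∂ρ) ^ n) *
        (n.factorial : ℝ≥0∞)⁻¹ ∂M.law x := by
        simp_rw [expSeries, ← ENNReal.tsum_mul_left, mul_assoc]
    _ = ∑' n : ℕ, (∫⁻ ω, g (M.X s ω) * (∫⁻ r, W (M.X (s + r) ω) ∂ρ) ^ n ∂M.law x) *
        (n.factorial : ℝ≥0∞)⁻¹ := by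
        exact lintegral_tsum_mul_const (fun n => hgX.mul (hA.pow_const n)) _
    _ = ∑' n : ℕ, (∫⁻ y, g y * ∫⁻ ω, (∫⁻ r, W (M.X r ω) ∂ρ) ^ n ∂M.law y
        ∂M.transition s x) * (n.factorial : ℝ≥0∞)⁻¹ := by
        simp_rw [M.lintegral_pow_shift ρ x s hg hW]
    _ = ∫⁻ y, ∑' n : ℕ, (g y * ∫⁻ ω, (∫⁻ r, W (M.X r ω) ∂ρ) ^ n ∂M.law y) *
        (n.factorial : ℝ≥0∞)⁻¹ ∂M.transition s x := by
        exact (lintegral_tsum_mul_const (fun n => hg.mul (hA0k n)) _).symm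
    _ = _ := by
        simp_rw [hsum, ← ENNReal.tsum_mul_left, mul_assoc]

end MarkovProcess

/-! ### Elementary estimates for bounded integrands -/

theorem integrable_of_bounded {α : Type*} [MeasurableSpace α] {ρ : Measure α} [IsFiniteMeasure ρ]
    {f : α → ℝ} (hf : Measurable f) {C : ℝ} (hC : ∀ a, |f a| ≤ C) : Integrable f ρ :=
  Integrable.of_bound (f := f) hf.aestronglyMeasurable C (ae_of_all _ hC)

theorem intervalIntegrable_of_bounded {f : ℝ → ℝ} (hf : Measurable f) {a b C : ℝ}
    (hC : ∀ r ∈ uIoc a b, |f r| ≤ C) : IntervalIntegrable f volume a b := by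
  rw [intervalIntegrable_iff]
  have : IsFiniteMeasure (volume.restrict (uIoc a b)) := by rw [uIoc]; infer_instance
  refine Integrable.of_bound (f := f) hf.aestronglyMeasurable C ?_
  filter_upwards [ae_restrict_mem measurableSet_uIoc] with r hr
  exact hC r hr

theorem abs_integral_le_of_bounded {α : Type*} [MeasurableSpace α] {ρ : Measure α}
    [IsProbabilityMeasure ρ] {f : α → ℝ} {C : ℝ} (hC : ∀ a, |f a| ≤ C) : |∫ a, f a ∂ρ| ≤ C := by
  simpa using norm_integral_le_of_norm_le_const (μ := ρ) (f := f) (ae_of_all _ hC)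

theorem abs_integral_sub_integral_le {α : Type*} [MeasurableSpace α] {ρ : Measure α}
    [IsProbabilityMeasure ρ] {f g : α → ℝ} (hf : Integrable f ρ) (hg : Integrable g ρ) {C : ℝ}
    (hC : ∀ a, |f a - g a| ≤ C) : |(∫ a, f a ∂ρ) - ∫ a, g a ∂ρ| ≤ C := by
  rw [← integral_sub hf hg]
  exact abs_integral_le_of_bounded hC

theorem intervalIntegral_swap_of_bounded {α : Type*} [MeasurableSpace α] {ρ : Measure α}
    [IsFiniteMeasure ρ] {f : ℝ → α → ℝ} (hf : Measurable (Function.uncurry f)) {a b C : ℝ}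
    (hC : ∀ r ∈ uIoc a b, ∀ y, |f r y| ≤ C) :
    ∫ r in a..b, (∫ y, f r y ∂ρ) = ∫ y, (∫ r in a..b, f r y) ∂ρ := by
  refine intervalIntegral_integral_swap ?_
  have : IsFiniteMeasure (volume.restrict (uIoc a b)) := by rw [uIoc]; infer_instance
  refine Integrable.of_bound hf.aestronglyMeasurable C ?_
  have h1 : ∀ᵐ p : ℝ × α ∂(volume.restrict (uIoc a b)).prod ρ, p.1 ∈ uIoc a b :=
    Measure.quasiMeasurePreserving_fst.ae (ae_restrict_mem measurableSet_uIoc)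
  filter_upwards [h1] with p hp
  exact hC _ hp _

theorem measurable_intervalIntegral {α : Type*} [MeasurableSpace α] {f : α → ℝ → ℝ}
    (hf : Measurable (Function.uncurry f)) (a b : ℝ) :
    Measurable fun y => ∫ r in a..b, f y r := by
  simp_rw [intervalIntegral.intervalIntegral_eq_integral_uIoc]
  have h : Measurable fun y => ∫ r in uIoc a b, f y r :=
    (hf.stronglyMeasurable.integral_prod_right (ν := volume.restrict (uIoc a b))).measurable
  exact h.const_smul (if a ≤ b then (1 : ℝ) else -1)

theorem abs_one_sub_exp_neg_sub_le {a : ℝ} (ha : 0 ≤ a) : |1 - Real.exp (-a) - a| ≤ a ^ 2 := by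
  have h1 := Real.add_one_le_exp (-a)
  have h2 := Real.add_one_le_exp a
  have h3 : Real.exp (-a) * Real.exp a = 1 := by rw [← Real.exp_add]; simp
  have h4 := Real.exp_pos (-a)
  have h5 : Real.exp (-a) * (a + 1) ≤ 1 := by nlinarith
  have h6 : Real.exp (-a) ≤ 1 - a + a ^ 2 := by
    have : 0 ≤ a ^ 3 := by positivity
    by_contra! h
    nlinarith
  rw [abs_le]
  constructor <;> nlinarith [sq_nonneg a]

theorem abs_exp_sub_exp_le {a b c : ℝ} (ha : a ≤ c) (hb : b ≤ c) :
    |Real.exp a - Real.exp b| ≤ Real.exp c * |a - b| := by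
  wlog h : b ≤ a generalizing a b
  · rw [abs_sub_comm, abs_sub_comm a b]
    exact this hb ha (le_of_not_ge h)
  rw [abs_of_nonneg (sub_nonneg.2 (Real.exp_le_exp.2 h)), abs_of_nonneg (sub_nonneg.2 h)]
  have h1 := Real.add_one_le_exp (b - a)
  have h2 : Real.exp b = Real.exp a * Real.exp (b - a) := by rw [← Real.exp_add]; ring_nf
  have h3 := Real.exp_le_exp.2 ha
  have h4 := Real.exp_pos a
  nlinarith

/-- A measurable potential with values in `[0, K]`. -/
structure IsBoundedPotential {E : Type*} [MeasurableSpace E] (W : E → ℝ) (K : ℝ) : Prop where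
  measurable : Measurable W
  nonneg : ∀ x, 0 ≤ W x
  le : ∀ x, W x ≤ K
  one_le : 1 ≤ K

/-! ### Additive functionals and the Feynman-Kac function of a bounded potential -/

namespace MarkovProcess

variable {E Ω : Type*} [MeasurableSpace E] [MeasurableSpace Ω] (M : MarkovProcess E Ω)

theorem semigroup_eq (t : ℝ≥0) {f : E → ℝ} (hf : Measurable f) (x : E) :
    M.semigroup t f x = ∫ ω, f (M.X t ω) ∂M.law x := by
  rw [semigroup, transition_apply, integral_map (M.measurable_at t).aemeasurable
    hf.aestronglyMeasurable]

/-- The additive functional `∫_0^t W(X_{s+r}) dr`. -/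
def pathIntegral (W : E → ℝ) (s : ℝ≥0) (t : ℝ) (ω : Ω) : ℝ :=
  ∫ r in (0 : ℝ)..t, W (M.X (s + r.toNNReal) ω)

theorem measurable_path {W : E → ℝ} (hW : Measurable W) (s : ℝ≥0) :
    Measurable fun p : Ω × ℝ => W (M.X (s + p.2.toNNReal) p.1) := by
  have h : Measurable fun p : Ω × ℝ => (p.2.toNNReal, p.1) := by fun_prop
  exact hW.comp ((M.measurable_shift s).comp h)

theorem measurable_pathIntegral {W : E → ℝ} (hW : Measurable W) (s : ℝ≥0) (t : ℝ) :
    Measurable (M.pathIntegral W s t) :=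
  measurable_intervalIntegral (f := fun ω r => W (M.X (s + r.toNNReal) ω))
    (M.measurable_path hW s) 0 t

theorem intervalIntegrable_path {W : E → ℝ} {K : ℝ} (hW : IsBoundedPotential W K) (s : ℝ≥0)
    (ω : Ω) (a b : ℝ) :
    IntervalIntegrable (fun r : ℝ => W (M.X (s + r.toNNReal) ω)) volume a b :=
  intervalIntegrable_of_bounded (f := fun r : ℝ => W (M.X (s + r.toNNReal) ω))
    ((M.measurable_path hW.measurable s).comp measurable_prodMk_left) fun _ _ => by rw [abs_of_nonneg (hW.nonneg _)]; exact hW.le _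

theorem pathIntegral_sub {W : E → ℝ} {K : ℝ} (hW : IsBoundedPotential W K) (s : ℝ≥0) (a b : ℝ)
    (ω : Ω) : M.pathIntegral W s b ω - M.pathIntegral W s a ω =
      ∫ r in a..b, W (M.X (s + r.toNNReal) ω) :=
  intervalIntegral.integral_interval_sub_left (M.intervalIntegrable_path hW s ω _ _)
    (M.intervalIntegrable_path hW s ω _ _)

theorem pathIntegral_sub_nonneg {W : E → ℝ} {K : ℝ} (hW : IsBoundedPotential W K) (s : ℝ≥0)
    {a b : ℝ} (hab : a ≤ b) (ω : Ω) :
    0 ≤ M.pathIntegral W s b ω - M.pathIntegral W s a ω := by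
  rw [M.pathIntegral_sub hW]
  exact intervalIntegral.integral_nonneg hab fun r _ => hW.nonneg _

theorem pathIntegral_sub_le {W : E → ℝ} {K : ℝ} (hW : IsBoundedPotential W K) (s : ℝ≥0)
    {a b : ℝ} (hab : a ≤ b) (ω : Ω) :
    M.pathIntegral W s b ω - M.pathIntegral W s a ω ≤ K * (b - a) := by
  rw [M.pathIntegral_sub hW]
  calc _ ≤ ∫ _ in a..b, K := intervalIntegral.integral_mono_on hab
        (M.intervalIntegrable_path hW s ω _ _) intervalIntegrable_const fun r _ => hW.le _
    _ = _ := by simp [mul_comm]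

theorem abs_pathIntegral_sub_le {W : E → ℝ} {K : ℝ} (hW : IsBoundedPotential W K) (s : ℝ≥0)
    (a b : ℝ) (ω : Ω) :
    |M.pathIntegral W s b ω - M.pathIntegral W s a ω| ≤ K * |b - a| := by
  rcases le_total a b with h | h
  · rw [abs_of_nonneg (M.pathIntegral_sub_nonneg hW s h ω), abs_of_nonneg (sub_nonneg.2 h)]
    exact M.pathIntegral_sub_le hW s h ω
  · rw [abs_sub_comm, abs_sub_comm b, abs_of_nonneg (M.pathIntegral_sub_nonneg hW s h ω),
      abs_of_nonneg (sub_nonneg.2 h)]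
    exact M.pathIntegral_sub_le hW s h ω

@[simp] theorem pathIntegral_zero (W : E → ℝ) (s : ℝ≥0) (ω : Ω) : M.pathIntegral W s 0 ω = 0 := by
  simp [pathIntegral]

theorem pathIntegral_nonneg {W : E → ℝ} {K : ℝ} (hW : IsBoundedPotential W K) (s : ℝ≥0)
    {t : ℝ} (ht : 0 ≤ t) (ω : Ω) : 0 ≤ M.pathIntegral W s t ω := by
  simpa using M.pathIntegral_sub_nonneg hW s ht ω

theorem pathIntegral_le {W : E → ℝ} {K : ℝ} (hW : IsBoundedPotential W K) (s : ℝ≥0)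
    {t T : ℝ} (ht : t ≤ T) (hT : 0 ≤ T) (ω : Ω) : M.pathIntegral W s t ω ≤ K * T := by
  have h1 := M.pathIntegral_sub_nonneg hW s ht ω
  have h2 := M.pathIntegral_sub_le hW s hT ω
  simp only [pathIntegral_zero, sub_zero] at h2
  linarith

theorem pathIntegral_add {W : E → ℝ} {K : ℝ} (hW : IsBoundedPotential W K) (s : ℝ≥0)
    {t : ℝ} (ht : 0 ≤ t) (ω : Ω) :
    M.pathIntegral W 0 (s + t) ω = M.pathIntegral W 0 s ω + M.pathIntegral W s t ω := by
  rw [← sub_eq_iff_eq_add', M.pathIntegral_sub hW]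
  have h := intervalIntegral.integral_comp_add_left (a := 0) (b := t)
    (fun r : ℝ => W (M.X (0 + r.toNNReal) ω)) (s : ℝ)
  rw [add_zero] at h
  rw [← h, pathIntegral]
  refine intervalIntegral.integral_congr fun r hr => ?_
  rw [uIcc_of_le ht] at hr
  simp only [zero_add]
  rw [Real.toNNReal_add s.coe_nonneg hr.1, Real.toNNReal_coe]

/-- The Feynman-Kac function `x ↦ 𝔼_x[exp(∫_0^t W(X_r) dr)]`. -/
def feynmanKac (W : E → ℝ) (t : ℝ) (x : E) : ℝ :=
  ∫ ω, Real.exp (M.pathIntegral W 0 t ω) ∂M.law x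

theorem measurable_exp_pathIntegral {W : E → ℝ} (hW : Measurable W) (s : ℝ≥0) (t : ℝ) :
    Measurable fun ω => Real.exp (M.pathIntegral W s t ω) :=
  (M.measurable_pathIntegral hW s t).exp

theorem abs_exp_pathIntegral_le {W : E → ℝ} {K : ℝ} (hW : IsBoundedPotential W K) (s : ℝ≥0)
    {t T : ℝ} (ht : t ≤ T) (hT : 0 ≤ T) (ω : Ω) :
    |Real.exp (M.pathIntegral W s t ω)| ≤ Real.exp (K * T) := by
  rw [abs_of_nonneg (Real.exp_nonneg _)]
  exact Real.exp_le_exp.2 (M.pathIntegral_le hW s ht hT ω)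

theorem integrable_exp_pathIntegral {W : E → ℝ} {K : ℝ} (hW : IsBoundedPotential W K) (s : ℝ≥0)
    (t : ℝ) (x : E) : Integrable (fun ω => Real.exp (M.pathIntegral W s t ω)) (M.law x) :=
  integrable_of_bounded (M.measurable_exp_pathIntegral hW.measurable s t)
    (M.abs_exp_pathIntegral_le hW s (le_abs_self t) (abs_nonneg t))

theorem measurable_feynmanKac {W : E → ℝ} (hW : Measurable W) (t : ℝ) :
    Measurable (M.feynmanKac W t) :=
  ((M.measurable_exp_pathIntegral hW 0 t).stronglyMeasurable.integral_kernel (κ := M.law)).measurable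

theorem feynmanKac_nonneg (W : E → ℝ) (t : ℝ) (x : E) : 0 ≤ M.feynmanKac W t x :=
  integral_nonneg fun _ => Real.exp_nonneg _

theorem feynmanKac_le {W : E → ℝ} {K : ℝ} (hW : IsBoundedPotential W K) {t T : ℝ} (ht : t ≤ T)
    (hT : 0 ≤ T) (x : E) : M.feynmanKac W t x ≤ Real.exp (K * T) :=
  (le_abs_self _).trans (abs_integral_le_of_bounded (M.abs_exp_pathIntegral_le hW 0 ht hT))

theorem feynmanKac_mono {W : E → ℝ} {K : ℝ} (hW : IsBoundedPotential W K) {s t : ℝ} (h : s ≤ t)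
    (x : E) : M.feynmanKac W s x ≤ M.feynmanKac W t x :=
  integral_mono (M.integrable_exp_pathIntegral hW 0 s x) (M.integrable_exp_pathIntegral hW 0 t x)
    fun ω => Real.exp_le_exp.2 (sub_nonneg.1 (M.pathIntegral_sub_nonneg hW 0 h ω))

theorem abs_feynmanKac_sub_le {W : E → ℝ} {K : ℝ} (hW : IsBoundedPotential W K) {a b T : ℝ}
    (ha : a ≤ T) (hb : b ≤ T) (hT : 0 ≤ T) (x : E) :
    |M.feynmanKac W b x - M.feynmanKac W a x| ≤ Real.exp (K * T) * K * |b - a| := by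
  refine abs_integral_sub_integral_le (M.integrable_exp_pathIntegral hW 0 b x)
    (M.integrable_exp_pathIntegral hW 0 a x) fun ω => ?_
  refine (abs_exp_sub_exp_le (M.pathIntegral_le hW 0 hb hT ω)
    (M.pathIntegral_le hW 0 ha hT ω)).trans ?_
  rw [mul_assoc]
  exact mul_le_mul_of_nonneg_left (M.abs_pathIntegral_sub_le hW 0 a b ω) (Real.exp_nonneg _)

theorem continuous_feynmanKac {W : E → ℝ} {K : ℝ} (hW : IsBoundedPotential W K) (x : E) :
    Continuous fun t => M.feynmanKac W t x := by
  refine continuous_iff_continuousAt.2 fun t => ?_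
  have h : ContinuousOn (fun t => M.feynmanKac W t x) (Iic (|t| + 1)) := by
    have : LipschitzOnWith (Real.exp (K * (|t| + 1)) * K).toNNReal
        (fun t => M.feynmanKac W t x) (Iic (|t| + 1)) :=
      LipschitzOnWith.of_dist_le_mul fun a ha b hb => by
        rw [Real.dist_eq, Real.dist_eq, Real.coe_toNNReal _ (by have := hW.one_le; positivity)]
        exact M.abs_feynmanKac_sub_le hW hb ha (by positivity) x
    exact this.continuousOn
  exact h.continuousAt (Iic_mem_nhds (by linarith [le_abs_self t]))

theorem measurable_uncurry_feynmanKac {W : E → ℝ} {K : ℝ} (hW : IsBoundedPotential W K) :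
    Measurable (Function.uncurry (M.feynmanKac W)) :=
  measurable_uncurry_of_continuous_of_measurable (M.continuous_feynmanKac hW)
    (M.measurable_feynmanKac hW.measurable)

/-- The process is indexed by `ℝ≥0` while path integrals run over real time. Pushing Lebesgue
measure on `(0, t]` forward under `Real.toNNReal` gives the measure on times for which the Markov
property was proved. -/
theorem ofReal_pathIntegral {W : E → ℝ} {K : ℝ} (hW : IsBoundedPotential W K) (s : ℝ≥0)
    {t : ℝ} (ht : 0 ≤ t) (ω : Ω) :
    ENNReal.ofReal (M.pathIntegral W s t ω) = ∫⁻ r, ENNReal.ofReal (W (M.X (s + r) ω))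
      ∂((volume.restrict (Ioc 0 t)).map Real.toNNReal) := by
  rw [pathIntegral, intervalIntegral.integral_of_le ht, ofReal_integral_eq_lintegral_ofReal
    ((intervalIntegrable_iff_integrableOn_Ioc_of_le ht).1 (M.intervalIntegrable_path hW s ω 0 t))
    (ae_of_all _ fun _ => hW.nonneg _), lintegral_map _ measurable_real_toNNReal]
  exact (hW.measurable.comp ((M.measurable_shift s).comp measurable_prodMk_right)).ennreal_ofReal

/-- The Markov property at time `s` for the Feynman-Kac functional. -/
theorem integral_exp_shift {W : E → ℝ} {K : ℝ} (hW : IsBoundedPotential W K) (s : ℝ≥0) {t : ℝ}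
    (ht : 0 ≤ t) {g : E → ℝ} (hg : Measurable g) (hg0 : ∀ x, 0 ≤ g x) (x : E) :
    ∫ ω, g (M.X s ω) * Real.exp (M.pathIntegral W s t ω) ∂M.law x =
      M.semigroup s (fun y => g y * M.feynmanKac W t y) x := by
  have hgX : Measurable fun ω => g (M.X s ω) := hg.comp (M.measurable_at s)
  have h := M.lintegral_expSeries_shift ((volume.restrict (Ioc 0 t)).map Real.toNNReal) x s
    hg.ennreal_ofReal hW.measurable.ennreal_ofReal
  have h0 := fun ω => M.ofReal_pathIntegral hW 0 ht ω
  simp only [zero_add] at h0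
  simp_rw [← M.ofReal_pathIntegral hW s ht, ← h0, expSeries_ofReal (M.pathIntegral_nonneg hW _ ht _),
    ← ENNReal.ofReal_mul (hg0 _)] at h
  have h2 : ∀ y, ∫⁻ ω, ENNReal.ofReal (Real.exp (M.pathIntegral W 0 t ω)) ∂M.law y =
      ENNReal.ofReal (M.feynmanKac W t y) := fun y =>
    (ofReal_integral_eq_lintegral_ofReal (M.integrable_exp_pathIntegral hW 0 t y)
      (ae_of_all _ fun _ => Real.exp_nonneg _)).symm
  simp_rw [h2, ← ENNReal.ofReal_mul (hg0 _)] at h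
  rw [semigroup, integral_eq_lintegral_of_nonneg_ae, integral_eq_lintegral_of_nonneg_ae, h]
  · exact ae_of_all _ fun y => mul_nonneg (hg0 y) (M.feynmanKac_nonneg W t y)
  · exact (hg.mul (M.measurable_feynmanKac hW.measurable t)).aestronglyMeasurable
  · exact ae_of_all _ fun ω => mul_nonneg (hg0 _) (Real.exp_nonneg _)
  · exact (hgX.mul (M.measurable_exp_pathIntegral hW.measurable s t)).aestronglyMeasurable

theorem measurable_semigroup (s : ℝ≥0) {f : E → ℝ} (hf : Measurable f) :
    Measurable (M.semigroup s f) :=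
  (hf.stronglyMeasurable.integral_kernel (κ := M.transition s)).measurable

theorem abs_semigroup_le (s : ℝ≥0) {f : E → ℝ} {C : ℝ} (hC : ∀ y, |f y| ≤ C) (x : E) :
    |M.semigroup s f x| ≤ C :=
  abs_integral_le_of_bounded hC

/-- Joint measurability of `(a, s, x) ↦ P_s (f a) x`. -/
theorem measurable_semigroup_uncurry {ι : Type*} [MeasurableSpace ι] {f : ι → E → ℝ}
    (hf : Measurable (Function.uncurry f)) :
    Measurable fun p : (ι × ℝ) × E => M.semigroup p.1.2.toNNReal (f p.1.1) p.2 := by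
  have h : ∀ p : (ι × ℝ) × E, M.semigroup p.1.2.toNNReal (f p.1.1) p.2 =
      ∫ ω, f p.1.1 (M.X p.1.2.toNNReal ω) ∂M.law p.2 := fun p =>
    M.semigroup_eq _ (hf.comp measurable_prodMk_left) _
  simp_rw [h]
  have hm : Measurable fun q : ((ι × ℝ) × E) × Ω => f q.1.1.1 (M.X q.1.1.2.toNNReal q.2) := by
    have h1 : Measurable fun q : ((ι × ℝ) × E) × Ω => (q.1.1.2.toNNReal, q.2) := by fun_prop
    have h2 := M.measurable_X.comp h1
    have h3 : Measurable fun q : ((ι × ℝ) × E) × Ω => q.1.1.1 := by fun_prop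
    exact hf.comp (h3.prodMk h2)
  have := hm.stronglyMeasurable.integral_kernel_prod_right'
    (κ := M.law.comap (Prod.snd : (ι × ℝ) × E → E) measurable_snd)
  simpa [Kernel.comap_apply] using this.measurable

theorem measurable_semigroup_time {f : E → ℝ} (hf : Measurable f) (x : E) :
    Measurable fun s : ℝ => M.semigroup s.toNNReal f x := by
  have h := M.measurable_semigroup_uncurry (ι := Unit) (f := fun _ => f)
    (hf.comp measurable_snd)
  have h2 : Measurable fun s : ℝ => ((((), s) : Unit × ℝ), x) := by fun_prop
  exact h.comp h2

/-- First-order Duhamel formula, with an error `O(h²)` uniform in `x`. Let `A_h` be the path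
integral over `[0, h]` and `Z = exp A_{t+h}`. By the Markov property the first difference is `𝔼_x[Z
(1 - exp(-A_h))]`. It is compared with `𝔼_x[Z A_h]`, and then with the integral of `P_s(W u_t)` over
`[0, h]`. Each comparison costs `K² exp(KT) h²`. -/
theorem abs_feynmanKac_duhamel_le {W : E → ℝ} {K : ℝ} (hW : IsBoundedPotential W K) {t : ℝ}
    (ht : 0 ≤ t) {h : ℝ≥0} {T : ℝ} (hT : t + h ≤ T) (x : E) :
    |M.feynmanKac W (t + h) x - M.semigroup h (M.feynmanKac W t) x -
      ∫ s in (0 : ℝ)..h, M.semigroup s.toNNReal (fun y => W y * M.feynmanKac W t y) x| ≤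
      2 * K ^ 2 * Real.exp (K * T) * (h : ℝ) ^ 2 := by
  have hK0 : 0 ≤ K := zero_le_one.trans hW.one_le
  have hh0 : (0 : ℝ) ≤ h := h.coe_nonneg
  have hT0 : 0 ≤ T := by linarith
  obtain ⟨Z, hZ⟩ : ∃ Z : Ω → ℝ, Z = fun ω => Real.exp (M.pathIntegral W 0 (t + h) ω) := ⟨_, rfl⟩
  have hZm : Measurable Z := hZ ▸ M.measurable_exp_pathIntegral hW.measurable 0 (t + h)
  have hZb : ∀ ω, |Z ω| ≤ Real.exp (K * T) := hZ ▸ M.abs_exp_pathIntegral_le hW 0 hT hT0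
  have hWX : Measurable fun p : Ω × ℝ => W (M.X p.2.toNNReal p.1) := by
    simpa using M.measurable_path hW.measurable 0
  have hWXb : ∀ (s : ℝ) ω, |W (M.X s.toNNReal ω)| ≤ K := fun s ω => by
    rw [abs_of_nonneg (hW.nonneg _)]; exact hW.le _
  have hA : ∀ ω, M.pathIntegral W 0 h ω = ∫ s in (0 : ℝ)..h, W (M.X s.toNNReal ω) := fun ω => by
    simp [pathIntegral]
  have hWZm : Measurable (Function.uncurry fun (s : ℝ) ω => W (M.X s.toNNReal ω) * Z ω) :=
    (hWX.comp measurable_swap).mul (hZm.comp measurable_snd)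
  have hWZb : ∀ (s : ℝ) ω, |W (M.X s.toNNReal ω) * Z ω| ≤ K * Real.exp (K * T) := fun s ω => by
    rw [abs_mul]
    exact mul_le_mul (hWXb s ω) (hZb ω) (abs_nonneg _) hK0
  have e1 : M.semigroup h (M.feynmanKac W t) x =
      ∫ ω, Real.exp (M.pathIntegral W h t ω) ∂M.law x := by
    simpa using (M.integral_exp_shift hW h ht (g := 1) measurable_one (fun _ => zero_le_one) x).symm
  have e2 : ∫ s in (0 : ℝ)..h, (∫ ω, W (M.X s.toNNReal ω) * Z ω ∂M.law x) =
      ∫ ω, M.pathIntegral W 0 h ω * Z ω ∂M.law x := by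
    rw [intervalIntegral_swap_of_bounded hWZm fun s _ ω => hWZb s ω]
    refine integral_congr_ae (ae_of_all _ fun ω => ?_)
    simp only
    rw [intervalIntegral.integral_mul_const, hA]
  -- First comparison: `|1 - exp(-A_h) - A_h| ≤ A_h² ≤ (Kh)²`, weighted by `Z ≤ exp(KT)`.
  have b1 : |M.feynmanKac W (t + h) x - M.semigroup h (M.feynmanKac W t) x -
      ∫ ω, M.pathIntegral W 0 h ω * Z ω ∂M.law x| ≤ Real.exp (K * T) * (K * h) ^ 2 := by
    have i3 : Integrable (fun ω => M.pathIntegral W 0 h ω * Z ω) (M.law x) := by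
      refine integrable_of_bounded ((M.measurable_pathIntegral hW.measurable 0 h).mul hZm)
        (C := K * h * Real.exp (K * T)) fun ω => ?_
      rw [abs_mul, abs_of_nonneg (M.pathIntegral_nonneg hW 0 hh0 ω)]
      exact mul_le_mul (M.pathIntegral_le hW 0 le_rfl hh0 ω) (hZb ω) (abs_nonneg _) (by positivity)
    rw [e1, feynmanKac, ← integral_sub (M.integrable_exp_pathIntegral hW 0 (t + h) x)
      (M.integrable_exp_pathIntegral hW h t x)]
    refine abs_integral_sub_integral_le ((M.integrable_exp_pathIntegral hW 0 (t + h) x).sub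
        (M.integrable_exp_pathIntegral hW h t x)) i3 fun ω => ?_
    rw [Pi.sub_apply]
    have hsplit := M.pathIntegral_add hW h ht ω
    have ha := M.pathIntegral_nonneg hW 0 hh0 ω
    have ha' := M.pathIntegral_le hW 0 (le_refl (h : ℝ)) hh0 ω
    have : Real.exp (M.pathIntegral W 0 (t + h) ω) - Real.exp (M.pathIntegral W h t ω) -
        M.pathIntegral W 0 h ω * Z ω =
        Z ω * (1 - Real.exp (-M.pathIntegral W 0 h ω) - M.pathIntegral W 0 h ω) := by
      have : Real.exp (M.pathIntegral W h t ω) = Z ω * Real.exp (-M.pathIntegral W 0 h ω) := by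
        rw [hZ, ← Real.exp_add, add_comm t, hsplit]
        ring_nf
      rw [this, hZ]
      ring
    rw [this, abs_mul]
    refine mul_le_mul (hZb ω) ((abs_one_sub_exp_neg_sub_le ha).trans ?_) (abs_nonneg _)
      (Real.exp_nonneg _)
    gcongr
  -- Second comparison: at time `s`, the exponent over `[0, t + h]` is replaced by the one over `[s,
  -- s + t]`. The two pieces dropped have total length `h`, so the exponents differ by at most `Kh`.
  have b2 : |(∫ s in (0 : ℝ)..h, (∫ ω, W (M.X s.toNNReal ω) * Z ω ∂M.law x)) -
      ∫ s in (0 : ℝ)..h, M.semigroup s.toNNReal (fun y => W y * M.feynmanKac W t y) x| ≤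
      K * (Real.exp (K * T) * (K * h)) * h := by
    have hm1 : Measurable fun s : ℝ => ∫ ω, W (M.X s.toNNReal ω) * Z ω ∂M.law x :=
      (hWZm.stronglyMeasurable.integral_prod_right (ν := M.law x)).measurable
    have hfW : Measurable fun y => W y * M.feynmanKac W t y :=
      hW.measurable.mul (M.measurable_feynmanKac hW.measurable t)
    have hfb : ∀ y, |W y * M.feynmanKac W t y| ≤ K * Real.exp (K * T) := fun y => by
      rw [abs_mul, abs_of_nonneg (hW.nonneg y), abs_of_nonneg (M.feynmanKac_nonneg W t y)]
      exact mul_le_mul (hW.le y) (M.feynmanKac_le hW (by linarith) hT0 y)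
        (M.feynmanKac_nonneg W t y) hK0
    rw [← intervalIntegral.integral_sub
      (intervalIntegrable_of_bounded hm1 fun s _ => abs_integral_le_of_bounded (hWZb s))
      (intervalIntegrable_of_bounded (M.measurable_semigroup_time hfW x)
        fun s _ => M.abs_semigroup_le _ hfb x)]
    have := intervalIntegral.norm_integral_le_of_norm_le_const (a := (0 : ℝ)) (b := h)
      (f := fun s : ℝ => (∫ ω, W (M.X s.toNNReal ω) * Z ω ∂M.law x) -
        M.semigroup s.toNNReal (fun y => W y * M.feynmanKac W t y) x)
      (C := K * (Real.exp (K * T) * (K * h))) ?_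
    · simpa [abs_of_nonneg hh0] using this
    · intro s hs
      rw [uIoc_of_le hh0] at hs
      have hs0 : ((s.toNNReal : ℝ≥0) : ℝ) = s := Real.coe_toNNReal s hs.1.le
      have hm2 : Measurable fun ω => W (M.X s.toNNReal ω) *
          Real.exp (M.pathIntegral W s.toNNReal t ω) :=
        (hW.measurable.comp (M.measurable_at _)).mul
          (M.measurable_exp_pathIntegral hW.measurable _ t)
      rw [Real.norm_eq_abs, ← M.integral_exp_shift hW _ ht hW.measurable hW.nonneg]
      refine abs_integral_sub_integral_le (f := fun ω => W (M.X s.toNNReal ω) * Z ω)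
        (integrable_of_bounded (hWZm.comp measurable_prodMk_left) (hWZb s))
        (integrable_of_bounded hm2 (C := K * Real.exp (K * T)) fun ω => ?_) fun ω => ?_
      rotate_left
      · rw [← mul_sub, abs_mul]
        refine mul_le_mul (hWXb s ω) ?_ (abs_nonneg _) hK0
        rw [hZ]
        refine (abs_exp_sub_exp_le (M.pathIntegral_le hW 0 hT hT0 ω)
          (M.pathIntegral_le hW _ (by linarith) hT0 ω)).trans
          (mul_le_mul_of_nonneg_left ?_ (Real.exp_nonneg _))
        have h1 := M.pathIntegral_add hW s.toNNReal ht ω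
        rw [hs0] at h1
        have h2 := M.pathIntegral_nonneg hW 0 hs.1.le ω
        have h3 := M.pathIntegral_le hW 0 (le_refl s) hs.1.le ω
        have h4 : s + t ≤ t + h := by linarith [hs.2]
        have h5 := M.pathIntegral_sub_nonneg hW 0 h4 ω
        have h6 := M.pathIntegral_sub_le hW 0 h4 ω
        rw [abs_of_nonneg (by linarith)]
        nlinarith
      · rw [abs_mul]
        exact mul_le_mul (hWXb s ω) (M.abs_exp_pathIntegral_le hW _ (by linarith) hT0 ω)
          (abs_nonneg _) hK0
  rw [e2] at b2
  rw [abs_le] at b1 b2 ⊢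
  constructor <;> nlinarith

/-! ### Time averages of the Feynman-Kac function -/

theorem semigroup_intervalIntegral (s : ℝ≥0) {f : ℝ → E → ℝ}
    (hf : Measurable (Function.uncurry f)) {a b C : ℝ} (hC : ∀ r ∈ uIoc a b, ∀ y, |f r y| ≤ C)
    (c : ℝ) (x : E) :
    M.semigroup s (fun y => c * ∫ r in a..b, f r y) x =
      c * ∫ r in a..b, M.semigroup s (f r) x := by
  simp only [semigroup]
  rw [integral_const_mul, intervalIntegral_swap_of_bounded hf hC]

/-- The time average over `[t, t + ε]` of the Feynman-Kac function. -/
def feynmanKacAverage (W : E → ℝ) (ε t : ℝ) (x : E) : ℝ :=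
  ε⁻¹ * ∫ r in (0 : ℝ)..ε, M.feynmanKac W (t + r) x

theorem measurable_uncurry_feynmanKac_add {W : E → ℝ} {K : ℝ} (hW : IsBoundedPotential W K)
    (t : ℝ) : Measurable (Function.uncurry fun r => M.feynmanKac W (t + r)) := by
  have h : Measurable fun p : ℝ × E => (t + p.1, p.2) := by fun_prop
  exact (M.measurable_uncurry_feynmanKac hW).comp h

theorem measurable_feynmanKacAverage {W : E → ℝ} {K : ℝ} (hW : IsBoundedPotential W K)
    (ε t : ℝ) : Measurable (M.feynmanKacAverage W ε t) :=
  (measurable_intervalIntegral (f := fun x r => M.feynmanKac W (t + r) x)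
    ((M.measurable_uncurry_feynmanKac_add hW t).comp measurable_swap) 0 ε).const_mul _

theorem abs_feynmanKac_le {W : E → ℝ} {K : ℝ} (hW : IsBoundedPotential W K) {t T : ℝ}
    (ht : t ≤ T) (hT : 0 ≤ T) (x : E) : |M.feynmanKac W t x| ≤ Real.exp (K * T) := by
  rw [abs_of_nonneg (M.feynmanKac_nonneg W t x)]
  exact M.feynmanKac_le hW ht hT x

theorem intervalIntegrable_feynmanKac {W : E → ℝ} {K : ℝ} (hW : IsBoundedPotential W K)
    (t : ℝ) (x : E) (a b : ℝ) :
    IntervalIntegrable (fun r => M.feynmanKac W (t + r) x) volume a b :=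
  ((M.continuous_feynmanKac hW x).comp (continuous_const.add continuous_id)).intervalIntegrable _ _

theorem abs_average_le {ε C : ℝ} (hε : 0 < ε) {f : ℝ → ℝ} (hf : ∀ r ∈ Ioc 0 ε, |f r| ≤ C) :
    |ε⁻¹ * ∫ r in (0 : ℝ)..ε, f r| ≤ C := by
  have h := intervalIntegral.norm_integral_le_of_norm_le_const (a := (0 : ℝ)) (b := ε) (f := f)
    (C := C) (by rw [uIoc_of_le hε.le]; exact hf)
  rw [sub_zero, Real.norm_eq_abs, abs_of_pos hε] at h
  rw [abs_mul, abs_of_pos (inv_pos.2 hε), inv_mul_le_iff₀ hε, mul_comm]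
  exact h

theorem abs_feynmanKacAverage_le {W : E → ℝ} {K : ℝ} (hW : IsBoundedPotential W K) {ε t T : ℝ}
    (hε : 0 < ε) (ht : t + ε ≤ T) (hT : 0 ≤ T) (x : E) :
    |M.feynmanKacAverage W ε t x| ≤ Real.exp (K * T) :=
  abs_average_le hε fun r hr => M.abs_feynmanKac_le hW (by linarith [hr.2]) hT x

/-- Since `W ≥ 0`, the Feynman-Kac function increases with time. This lets an estimate on the
averages pass back to the function itself. -/
theorem feynmanKac_le_average {W : E → ℝ} {K : ℝ} (hW : IsBoundedPotential W K) {ε : ℝ}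
    (hε : 0 < ε) (t : ℝ) (x : E) : M.feynmanKac W t x ≤ M.feynmanKacAverage W ε t x := by
  rw [feynmanKacAverage, le_inv_mul_iff₀ hε]
  calc _ = ∫ _ in (0 : ℝ)..ε, M.feynmanKac W t x := by simp
    _ ≤ _ := intervalIntegral.integral_mono_on hε.le intervalIntegrable_const
      (M.intervalIntegrable_feynmanKac hW t x 0 ε)
      fun r hr => M.feynmanKac_mono hW (by linarith [hr.1]) x

theorem hasDerivAt_feynmanKacAverage {W : E → ℝ} {K : ℝ} (hW : IsBoundedPotential W K)
    (ε t : ℝ) (x : E) :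
    HasDerivAt (fun t => M.feynmanKacAverage W ε t x)
      (ε⁻¹ * (M.feynmanKac W (t + ε) x - M.feynmanKac W t x)) t := by
  have hc := M.continuous_feynmanKac hW x
  have hd : ∀ a, HasDerivAt (fun a => ∫ r in (0 : ℝ)..a, M.feynmanKac W r x)
      (M.feynmanKac W a x) a := fun a => (hc.integral_hasStrictDerivAt 0 a).hasDerivAt
  have h : ∀ t, M.feynmanKacAverage W ε t x = ε⁻¹ * ((∫ r in (0 : ℝ)..(t + ε),
      M.feynmanKac W r x) - ∫ r in (0 : ℝ)..t, M.feynmanKac W r x) := fun t => by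
    rw [feynmanKacAverage, intervalIntegral.integral_interval_sub_left
      (hc.intervalIntegrable _ _) (hc.intervalIntegrable _ _),
      intervalIntegral.integral_comp_add_left (fun r => M.feynmanKac W r x), add_zero]
  simp_rw [h]
  exact (((hd (t + ε)).comp_add_const t ε).sub (hd t)).const_mul _

/-- Averaging makes the function differentiable in time, with a derivative that is Lipschitz
uniformly in `x`. The mean value inequality for `r ↦ v_r - r d_t`, where `v` is the average and `d`
its time derivative, gives a quadratic remainder. -/
theorem abs_feynmanKacAverage_sub_le {W : E → ℝ} {K : ℝ} (hW : IsBoundedPotential W K)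
    {ε t h T : ℝ} (hε : 0 < ε) (hh : 0 ≤ h) (ht : t + ε + h ≤ T) (hT : 0 ≤ T) (x : E) :
    |M.feynmanKacAverage W ε (t + h) x - M.feynmanKacAverage W ε t x -
      h * (ε⁻¹ * (M.feynmanKac W (t + ε) x - M.feynmanKac W t x))| ≤
      2 * ε⁻¹ * (Real.exp (K * T) * K) * h ^ 2 := by
  obtain ⟨d, hd⟩ : ∃ d : ℝ → ℝ, d = fun t =>
    ε⁻¹ * (M.feynmanKac W (t + ε) x - M.feynmanKac W t x) := ⟨_, rfl⟩
  have hK0 : 0 ≤ K := zero_le_one.trans hW.one_le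
  have key := Convex.norm_image_sub_le_of_norm_hasDerivWithin_le (𝕜 := ℝ) (s := Icc t (t + h))
    (f := fun r => M.feynmanKacAverage W ε r x - r * d t) (f' := fun r => d r - d t)
    (C := 2 * ε⁻¹ * (Real.exp (K * T) * K) * h) (x := t) (y := t + h) ?_ ?_ (convex_Icc _ _)
    (by simp [hh]) (by simp [hh])
  · rw [Real.norm_eq_abs, Real.norm_eq_abs, add_sub_cancel_left, abs_of_nonneg hh, hd] at key
    rw [pow_two, ← mul_assoc (2 * ε⁻¹ * (Real.exp (K * T) * K))]
    refine le_of_eq_of_le ?_ key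
    congr 1
    ring
  · intro r _
    rw [hd]
    have h1 := ((M.hasDerivAt_feynmanKacAverage hW ε r x).sub
      ((hasDerivAt_id r).mul_const (d t))).hasDerivWithinAt (s := Icc t (t + h))
    rw [one_mul, hd] at h1
    exact h1
  · intro r hr
    have h1 := M.abs_feynmanKac_sub_le hW (a := t + ε) (b := r + ε) (T := T) (by linarith)
      (by linarith [hr.2]) hT x
    have h2 := M.abs_feynmanKac_sub_le hW (a := t) (b := r) (T := T) (by linarith)
      (by linarith [hr.2]) hT x
    have h3 : r + ε - (t + ε) = r - t := by ring
    have h4 : |r - t| ≤ h := by rw [abs_of_nonneg (by linarith [hr.1])]; linarith [hr.2]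
    rw [h3] at h1
    have h5 : d r - d t = ε⁻¹ * ((M.feynmanKac W (r + ε) x - M.feynmanKac W (t + ε) x) -
        (M.feynmanKac W r x - M.feynmanKac W t x)) := by rw [hd]; ring
    have h6 : Real.exp (K * T) * K * |r - t| ≤ Real.exp (K * T) * K * h := by gcongr
    rw [h5, Real.norm_eq_abs, abs_mul, abs_of_pos (inv_pos.2 hε)]
    calc _ ≤ ε⁻¹ * (Real.exp (K * T) * K * h + Real.exp (K * T) * K * h) := by
          gcongr
          exact (abs_sub _ _).trans (add_le_add (h1.trans h6) (h2.trans h6))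
      _ = _ := by ring

/-- The Duhamel error is uniform over the averaging window, and by Fubini the semigroup commutes
with time averages. -/
theorem abs_feynmanKacAverage_duhamel_le {W : E → ℝ} {K : ℝ} (hW : IsBoundedPotential W K)
    {ε t : ℝ} (hε : 0 < ε) (ht : 0 ≤ t) {h : ℝ≥0} {T : ℝ} (hT : t + ε + h ≤ T) (x : E) :
    |M.feynmanKacAverage W ε (t + h) x - M.semigroup h (M.feynmanKacAverage W ε t) x -
      ∫ s in (0 : ℝ)..h, M.semigroup s.toNNReal
        (fun y => W y * M.feynmanKacAverage W ε t y) x| ≤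
      2 * K ^ 2 * Real.exp (K * T) * (h : ℝ) ^ 2 := by
  have hK0 : 0 ≤ K := zero_le_one.trans hW.one_le
  have hh0 : (0 : ℝ) ≤ h := h.coe_nonneg
  have hT0 : 0 ≤ T := by linarith
  have hu := M.measurable_uncurry_feynmanKac_add hW t
  have hub : ∀ r ∈ uIoc 0 ε, ∀ y, |M.feynmanKac W (t + r) y| ≤ Real.exp (K * T) := by
    intro r hr y
    rw [uIoc_of_le hε.le] at hr
    exact M.abs_feynmanKac_le hW (by linarith [hr.2]) hT0 y
  have hWu : Measurable (Function.uncurry fun r y => W y * M.feynmanKac W (t + r) y) :=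
    (hW.measurable.comp measurable_snd).mul hu
  have hWub : ∀ r ∈ uIoc 0 ε, ∀ y, |W y * M.feynmanKac W (t + r) y| ≤ K * Real.exp (K * T) := by
    intro r hr y
    rw [abs_mul, abs_of_nonneg (hW.nonneg y)]
    exact mul_le_mul (hW.le y) (hub r hr y) (abs_nonneg _) hK0
  have e1 := M.semigroup_intervalIntegral h hu hub ε⁻¹ x
  have hSm : Measurable (Function.uncurry fun r s : ℝ => M.semigroup s.toNNReal
      (fun y => W y * M.feynmanKac W (t + r) y) x) := by
    have h1 : Measurable fun p : ℝ × ℝ => (p, x) := by fun_prop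
    exact (M.measurable_semigroup_uncurry hWu).comp h1
  have hSb : ∀ r ∈ uIoc 0 ε, ∀ s : ℝ, |M.semigroup s.toNNReal
      (fun y => W y * M.feynmanKac W (t + r) y) x| ≤ K * Real.exp (K * T) :=
    fun r hr s => M.abs_semigroup_le _ (hWub r hr) x
  have e2 : ∫ s in (0 : ℝ)..h, M.semigroup s.toNNReal
        (fun y => W y * M.feynmanKacAverage W ε t y) x =
      ε⁻¹ * ∫ r in (0 : ℝ)..ε, (∫ s in (0 : ℝ)..h, M.semigroup s.toNNReal
        (fun y => W y * M.feynmanKac W (t + r) y) x) := by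
    have : ∀ s : ℝ, M.semigroup s.toNNReal (fun y => W y * M.feynmanKacAverage W ε t y) x =
        ε⁻¹ * ∫ r in (0 : ℝ)..ε, M.semigroup s.toNNReal
          (fun y => W y * M.feynmanKac W (t + r) y) x := by
      intro s
      rw [← M.semigroup_intervalIntegral s.toNNReal hWu hWub ε⁻¹ x]
      congr 1
      ext y
      rw [intervalIntegral.integral_const_mul, feynmanKacAverage]
      ring
    simp_rw [this]
    rw [intervalIntegral.integral_const_mul]
    congr 1
    simp_rw [intervalIntegral.integral_of_le hh0]
    exact (intervalIntegral_swap_of_bounded (ρ := volume.restrict (Ioc (0 : ℝ) h)) hSm hSb).symm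
  have e3 : M.feynmanKacAverage W ε (t + h) x =
      ε⁻¹ * ∫ r in (0 : ℝ)..ε, M.feynmanKac W (t + r + h) x := by
    rw [feynmanKacAverage]
    congr 1
    refine intervalIntegral.integral_congr fun r _ => ?_
    exact congrArg (M.feynmanKac W · x) (by ring)
  have i1 : IntervalIntegrable (fun r => M.feynmanKac W (t + r + h) x) volume 0 ε :=
    ((M.continuous_feynmanKac hW x).comp (by fun_prop : Continuous fun r : ℝ => t + r + h)
      ).intervalIntegrable _ _
  have i2 : IntervalIntegrable (fun r => M.semigroup h (M.feynmanKac W (t + r)) x) volume 0 ε := by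
    refine intervalIntegrable_of_bounded ?_ fun r hr => M.abs_semigroup_le h (hub r hr) x
    have h1 : Measurable fun r : ℝ => ((r, (h : ℝ)), x) := by fun_prop
    have h2 := (M.measurable_semigroup_uncurry hu).comp h1
    simp only [Function.comp_def, Real.toNNReal_coe] at h2
    exact h2
  have i3 : IntervalIntegrable (fun r => ∫ s in (0 : ℝ)..h, M.semigroup s.toNNReal
        (fun y => W y * M.feynmanKac W (t + r) y) x) volume 0 ε := by
    refine intervalIntegrable_of_bounded (measurable_intervalIntegral hSm 0 h)
      (C := K * Real.exp (K * T) * |(h : ℝ) - 0|) fun r hr => ?_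
    exact intervalIntegral.norm_integral_le_of_norm_le_const
      (f := fun s => M.semigroup s.toNNReal (fun y => W y * M.feynmanKac W (t + r) y) x)
      fun s _ => hSb r hr s
  have e1' : M.semigroup h (M.feynmanKacAverage W ε t) x =
      ε⁻¹ * ∫ r in (0 : ℝ)..ε, M.semigroup h (M.feynmanKac W (t + r)) x := e1
  rw [e1', e2, e3, ← mul_sub, ← mul_sub, ← intervalIntegral.integral_sub i1 i2,
    ← intervalIntegral.integral_sub (i1.sub i2) i3]
  refine abs_average_le hε fun r hr => ?_
  exact M.abs_feynmanKac_duhamel_le hW (by linarith [hr.1]) (by linarith [hr.2]) x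

end MarkovProcess

/-! ### The generator on time averages and the energy estimate -/

theorem eLpNorm_two_sq {α : Type*} [MeasurableSpace α] {ρ : Measure α} (f : α → ℝ) :
    eLpNorm f 2 ρ ^ 2 = ∫⁻ a, ‖f a‖ₑ ^ 2 ∂ρ := by
  have h := eLpNorm_nnreal_pow_eq_lintegral (f := f) (μ := ρ) (p := 2) two_ne_zero
  simpa using h

/-- Minkowski's integral inequality in `L²`, for an average. -/
theorem eLpNorm_two_integral_le {α β : Type*} [MeasurableSpace α] [MeasurableSpace β]
    {ρ : Measure α} [IsProbabilityMeasure ρ] {μ : Measure β} [SFinite μ] {f : α → β → ℝ}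
    (hf : Measurable (Function.uncurry f)) {δ : ℝ≥0∞} (hδ : ∀ᵐ s ∂ρ, eLpNorm (f s) 2 μ ≤ δ) :
    eLpNorm (fun x => ∫ s, f s x ∂ρ) 2 μ ≤ δ := by
  refine (ENNReal.pow_le_pow_left_iff two_ne_zero).1 ?_
  rw [eLpNorm_two_sq]
  calc ∫⁻ x, ‖∫ s, f s x ∂ρ‖ₑ ^ 2 ∂μ ≤ ∫⁻ x, ∫⁻ s, ‖f s x‖ₑ ^ 2 ∂ρ ∂μ := by
        refine lintegral_mono fun x => ?_
        rw [← eLpNorm_two_sq fun s => f s x]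
        gcongr
        calc ‖∫ s, f s x ∂ρ‖ₑ ≤ eLpNorm (fun s => f s x) 1 ρ := by
              rw [eLpNorm_one_eq_lintegral_enorm]
              exact enorm_integral_le_lintegral_enorm _
          _ ≤ _ := eLpNorm_le_eLpNorm_of_exponent_le one_le_two
              (hf.comp measurable_prodMk_right).aestronglyMeasurable
    _ = ∫⁻ s, ∫⁻ x, ‖f s x‖ₑ ^ 2 ∂μ ∂ρ :=
        lintegral_lintegral_swap ((hf.enorm.pow_const 2).comp measurable_swap).aemeasurable
    _ ≤ ∫⁻ _, δ ^ 2 ∂ρ := by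
        refine lintegral_mono_ae (hδ.mono fun s hs => ?_)
        rw [← eLpNorm_two_sq]
        gcongr
    _ = δ ^ 2 := by simp

namespace MarkovProcess

variable {E Ω : Type*} [MeasurableSpace E] [MeasurableSpace Ω] (M : MarkovProcess E Ω)

theorem memLp_of_bounded {μ : Measure E} [IsFiniteMeasure μ] {f : E → ℝ} (hf : Measurable f)
    {C : ℝ} (hC : ∀ x, |f x| ≤ C) (p : ℝ≥0∞) : MemLp f p μ :=
  MemLp.of_bound hf.aestronglyMeasurable C (ae_of_all _ hC)

/-- The difference is the mean of `P_s b - b` over `s ∈ (0, h]`. Minkowski's inequality bounds its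
norm by the largest `‖P_s b - b‖`, which tends to `0` by strong continuity. -/
theorem tendsto_average_semigroup {μ : Measure E} [IsProbabilityMeasure μ]
    (hcont : M.IsStronglyContinuous μ) {b : E → ℝ} (hb : Measurable b) {C : ℝ}
    (hC : ∀ x, |b x| ≤ C) :
    Tendsto (fun h : ℝ≥0 => eLpNorm (fun x => (h : ℝ)⁻¹ *
      (∫ s in (0 : ℝ)..h, M.semigroup s.toNNReal b x) - b x) 2 μ) (𝓝[>] 0) (𝓝 0) := by
  have hc := hcont b (memLp_of_bounded hb hC 2)
  rw [ENNReal.tendsto_nhds_zero] at hc ⊢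
  intro δ hδ
  obtain ⟨u, hu, hsub⟩ := mem_nhdsGT_iff_exists_Ioo_subset.1 (hc δ hδ)
  filter_upwards [Ioo_mem_nhdsGT (show (0 : ℝ≥0) < u from hu)] with h hh
  have hh0 : (0 : ℝ) < h := hh.1
  obtain ⟨ρ, hρ⟩ : ∃ ρ : Measure ℝ, ρ = ENNReal.ofReal (h : ℝ)⁻¹ •
    volume.restrict (Ioc (0 : ℝ) h) := ⟨_, rfl⟩
  have hρP : IsProbabilityMeasure ρ := ⟨by
    rw [hρ, Measure.smul_apply, Measure.restrict_apply_univ, Real.volume_Ioc, sub_zero, smul_eq_mul,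
      ← ENNReal.ofReal_mul (by positivity), inv_mul_cancel₀ hh0.ne', ENNReal.ofReal_one]⟩
  have hS := M.measurable_semigroup_time hb
  have hSint : ∀ x, Integrable (fun s : ℝ => M.semigroup s.toNNReal b x) ρ := fun x =>
    integrable_of_bounded (hS x) fun s => M.abs_semigroup_le _ hC x
  have heq : (fun x => (h : ℝ)⁻¹ * (∫ s in (0 : ℝ)..h, M.semigroup s.toNNReal b x) - b x) =
      fun x => ∫ s, (M.semigroup s.toNNReal b x - b x) ∂ρ := by
    ext x
    rw [integral_sub (hSint x) (integrable_const _), integral_const, probReal_univ, one_smul,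
      hρ, integral_smul_measure, intervalIntegral.integral_of_le hh0.le,
      ENNReal.toReal_ofReal (by positivity), smul_eq_mul]
  have hm : Measurable (Function.uncurry fun (s : ℝ) x => M.semigroup s.toNNReal b x - b x) := by
    have h1 := M.measurable_semigroup_uncurry (ι := Unit) (f := fun _ => b)
      (hb.comp measurable_snd)
    have h2 : Measurable fun p : ℝ × E => ((((), p.1) : Unit × ℝ), p.2) := by fun_prop
    exact (h1.comp h2).sub (hb.comp measurable_snd)
  have hle : ∀ᵐ s ∂ρ, eLpNorm (fun x => M.semigroup s.toNNReal b x - b x) 2 μ ≤ δ := by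
    rw [hρ]
    refine Measure.ae_smul_measure ?_ _
    filter_upwards [ae_restrict_mem measurableSet_Ioc] with s hs
    have h1 : s.toNNReal ∈ Ioo 0 u :=
      ⟨Real.toNNReal_pos.2 hs.1, (Real.toNNReal_le_iff_le_coe.2 hs.2).trans_lt hh.2⟩
    exact hsub h1
  rw [heq]
  exact eLpNorm_two_integral_le hm hle

/-- Time averages of the Feynman-Kac function lie in the domain of the generator. -/
theorem generatorGraph_feynmanKacAverage {μ : Measure E} [IsProbabilityMeasure μ]
    (hcont : M.IsStronglyContinuous μ) {W : E → ℝ} {K : ℝ} (hW : IsBoundedPotential W K)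
    {ε t : ℝ} (hε : 0 < ε) (ht : 0 ≤ t) :
    M.GeneratorGraph μ (M.feynmanKacAverage W ε t) fun x =>
      ε⁻¹ * (M.feynmanKac W (t + ε) x - M.feynmanKac W t x) -
        W x * M.feynmanKacAverage W ε t x := by
  have hK0 : 0 ≤ K := zero_le_one.trans hW.one_le
  obtain ⟨T, hT⟩ : ∃ T, T = t + ε + 1 := ⟨_, rfl⟩
  have hT0 : 0 ≤ T := by linarith
  have hv := M.measurable_feynmanKacAverage hW ε t
  have hvb : ∀ x, |M.feynmanKacAverage W ε t x| ≤ Real.exp (K * T) :=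
    M.abs_feynmanKacAverage_le hW hε (by linarith) hT0
  have hWv : Measurable fun x => W x * M.feynmanKacAverage W ε t x := hW.measurable.mul hv
  have hWvb : ∀ x, |W x * M.feynmanKacAverage W ε t x| ≤ K * Real.exp (K * T) := fun x => by
    rw [abs_mul, abs_of_nonneg (hW.nonneg x)]
    exact mul_le_mul (hW.le x) (hvb x) (abs_nonneg _) hK0
  refine ⟨memLp_of_bounded hv hvb 2, ?_, ?_⟩
  · refine MemLp.sub ?_ (memLp_of_bounded hWv hWvb 2)
    refine MemLp.const_mul ?_ _
    exact (memLp_of_bounded (M.measurable_feynmanKac hW.measurable _)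
      (M.abs_feynmanKac_le hW (by linarith) hT0) 2).sub
      (memLp_of_bounded (M.measurable_feynmanKac hW.measurable _)
      (M.abs_feynmanKac_le hW (by linarith : t ≤ T) hT0) 2)
  · obtain ⟨C, hC⟩ : ∃ C, C = 2 * ε⁻¹ * (Real.exp (K * T) * K) + 2 * K ^ 2 * Real.exp (K * T) :=
      ⟨_, rfl⟩
    have havg := M.tendsto_average_semigroup hcont hWv hWvb
    have hlim : Tendsto (fun h : ℝ≥0 => ENNReal.ofReal (C * h) + eLpNorm (fun x => (h : ℝ)⁻¹ *
        (∫ s in (0 : ℝ)..h, M.semigroup s.toNNReal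
          (fun y => W y * M.feynmanKacAverage W ε t y) x) -
        W x * M.feynmanKacAverage W ε t x) 2 μ) (𝓝[>] 0) (𝓝 0) := by
      have h1 : Tendsto (fun h : ℝ≥0 => ENNReal.ofReal (C * h)) (𝓝[>] 0) (𝓝 0) := by
        have : Continuous fun h : ℝ≥0 => ENNReal.ofReal (C * h) :=
          ENNReal.continuous_ofReal.comp (by fun_prop)
        have h2 := this.tendsto 0
        simp only [NNReal.coe_zero, mul_zero, ENNReal.ofReal_zero] at h2
        exact h2.mono_left nhdsWithin_le_nhds
      simpa using h1.add havg
    refine tendsto_of_tendsto_of_tendsto_of_le_of_le' tendsto_const_nhds hlim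
      (Eventually.of_forall fun _ => zero_le) ?_
    filter_upwards [Ioo_mem_nhdsGT (zero_lt_one : (0 : ℝ≥0) < 1)] with h hh
    have hh0 : (0 : ℝ) < h := hh.1
    have hh1 : (h : ℝ) < 1 := hh.2
    have hRm : Measurable fun x => (h : ℝ)⁻¹ *
        (∫ s in (0 : ℝ)..h, M.semigroup s.toNNReal
          (fun y => W y * M.feynmanKacAverage W ε t y) x) -
        W x * M.feynmanKacAverage W ε t x := by
      refine Measurable.sub (Measurable.const_mul ?_ _) hWv
      refine measurable_intervalIntegral (f := fun x s => M.semigroup s.toNNReal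
          (fun y => W y * M.feynmanKacAverage W ε t y) x) ?_ 0 h
      have h1 := M.measurable_semigroup_uncurry (ι := Unit)
        (f := fun _ y => W y * M.feynmanKacAverage W ε t y) (hWv.comp measurable_snd)
      have h2 : Measurable fun p : E × ℝ => ((((), p.2) : Unit × ℝ), p.1) := by fun_prop
      exact h1.comp h2
    calc _ ≤ eLpNorm ((fun _ => C * (h : ℝ)) + fun x => ‖(h : ℝ)⁻¹ *
          (∫ s in (0 : ℝ)..h, M.semigroup s.toNNReal
            (fun y => W y * M.feynmanKacAverage W ε t y) x) -
          W x * M.feynmanKacAverage W ε t x‖) 2 μ := by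
          refine eLpNorm_mono_real fun x => ?_
          have h1 := M.abs_feynmanKacAverage_sub_le hW hε hh0.le (T := T) (t := t)
            (by linarith) hT0 x
          have h2 := M.abs_feynmanKacAverage_duhamel_le hW hε ht (h := h) (T := T)
            (by linarith) x
          obtain ⟨D, hD⟩ : ∃ D, D = ε⁻¹ * (M.feynmanKac W (t + ε) x - M.feynmanKac W t x) :=
            ⟨_, rfl⟩
          obtain ⟨I, hI⟩ : ∃ I, I = ∫ s in (0 : ℝ)..h, M.semigroup s.toNNReal
            (fun y => W y * M.feynmanKacAverage W ε t y) x := ⟨_, rfl⟩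
          rw [← hD] at h1 ⊢
          rw [← hI] at h2
          rw [Pi.add_apply, ← hI, Real.norm_eq_abs, Real.norm_eq_abs]
          -- With `v` the average, `P_h v_t - v_t = (v_{t+h} - v_t) - (v_{t+h} - P_h v_t)`. The
          -- first bracket is `h D + O(h²)`, and the second is the integral `I` of `P_s(W v_t)` up
          -- to `O(h²)`. After division by `h` only the convergence `I / h → W v_t` remains.
          have h3 : (h : ℝ)⁻¹ * (M.semigroup h (M.feynmanKacAverage W ε t) x -
              M.feynmanKacAverage W ε t x) - (D - W x * M.feynmanKacAverage W ε t x) =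
              (h : ℝ)⁻¹ * ((M.feynmanKacAverage W ε (t + h) x - M.feynmanKacAverage W ε t x -
                h * D) - (M.feynmanKacAverage W ε (t + h) x -
                M.semigroup h (M.feynmanKacAverage W ε t) x - I)) -
              ((h : ℝ)⁻¹ * I - W x * M.feynmanKacAverage W ε t x) := by
            field_simp
            ring
          rw [h3]
          refine (abs_sub _ _).trans (add_le_add ?_ le_rfl)
          rw [abs_mul, abs_of_pos (inv_pos.2 hh0), inv_mul_le_iff₀ hh0]
          refine (abs_sub _ _).trans ((add_le_add h1 h2).trans (le_of_eq ?_))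
          rw [hC]
          ring
      _ ≤ _ := by
          refine (eLpNorm_add_le aestronglyMeasurable_const hRm.norm.aestronglyMeasurable
            one_le_two).trans (add_le_add ?_ (eLpNorm_norm _).le)
          refine (eLpNorm_le_of_ae_bound (C := C * h) (ae_of_all _ fun _ => ?_)).trans ?_
          · rw [Real.norm_eq_abs, abs_of_nonneg]
            rw [hC]
            positivity
          · simp

/-- Energy estimate for the Feynman-Kac functional: a form bound on bounded elements of the domain
bounds the growth of its `L²` norm. -/
theorem integral_feynmanKac_sq_le {μ : Measure E} [IsProbabilityMeasure μ]
    (hcont : M.IsStronglyContinuous μ) {W : E → ℝ} {K : ℝ} (hW : IsBoundedPotential W K) {Λ : ℝ}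
    (hΛ : ∀ f g : E → ℝ, Measurable f → (∃ C, ∀ x, |f x| ≤ C) → M.GeneratorGraph μ f g →
      ∫ x, W x * f x ^ 2 ∂μ + ∫ x, g x * f x ∂μ ≤ Λ * ∫ x, f x ^ 2 ∂μ)
    {t : ℝ} (ht : 0 ≤ t) :
    ∫ x, M.feynmanKac W t x ^ 2 ∂μ ≤ Real.exp (2 * Λ * t) := by
  have hK0 : 0 ≤ K := zero_le_one.trans hW.one_le
  have main : ∀ ε : ℝ, 0 < ε →
      ∫ x, M.feynmanKac W t x ^ 2 ∂μ ≤ Real.exp (K * ε) ^ 2 * Real.exp (2 * Λ * t) := by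
    intro ε hε
    obtain ⟨v, hv⟩ : ∃ v, v = M.feynmanKacAverage W ε := ⟨_, rfl⟩
    obtain ⟨d, hd⟩ : ∃ d : ℝ → E → ℝ, d = fun t x =>
      ε⁻¹ * (M.feynmanKac W (t + ε) x - M.feynmanKac W t x) := ⟨_, rfl⟩
    have hvm : ∀ s, Measurable (v s) := fun s => hv ▸ M.measurable_feynmanKacAverage hW ε s
    have hdm : ∀ s, Measurable (d s) := fun s => by
      rw [hd]
      exact ((M.measurable_feynmanKac hW.measurable _).sub
        (M.measurable_feynmanKac hW.measurable _)).const_mul _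
    have hvb : ∀ T, 0 ≤ T → ∀ s, s + ε ≤ T → ∀ x, |v s x| ≤ Real.exp (K * T) :=
      fun T hT s hs x => hv ▸ M.abs_feynmanKacAverage_le hW hε hs hT x
    have hdb : ∀ T, 0 ≤ T → ∀ s, s + ε ≤ T → ∀ x, |d s x| ≤ Real.exp (K * T) * K := by
      intro T hT s hs x
      have := M.abs_feynmanKac_sub_le hW (a := s) (b := s + ε) (by linarith) hs hT x
      rw [add_sub_cancel_left, abs_of_pos hε] at this
      rw [hd, abs_mul, abs_of_pos (inv_pos.2 hε), inv_mul_le_iff₀ hε]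
      linarith
    have hvd : ∀ s x, HasDerivAt (fun s => v s x) (d s x) s := fun s x => by
      rw [hv, hd]; exact M.hasDerivAt_feynmanKacAverage hW ε s x
    have hφ : ∀ s, HasDerivAt (fun s => ∫ x, v s x ^ 2 ∂μ) (∫ x, 2 * v s x * d s x ∂μ) s := by
      intro s
      obtain ⟨T, hT⟩ : ∃ T, T = |s| + 1 + ε := ⟨_, rfl⟩
      have hT0 : 0 ≤ T := by linarith [abs_nonneg s]
      refine (hasDerivAt_integral_of_dominated_loc_of_deriv_le (s := Iio (|s| + 1))
        (F' := fun s x => 2 * v s x * d s x)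
        (bound := fun _ => 2 * Real.exp (K * T) * (Real.exp (K * T) * K))
        (Iio_mem_nhds (by linarith [le_abs_self s])) ?_ ?_ ?_ ?_ ?_ ?_).2
      · exact Eventually.of_forall fun s => ((hvm s).pow_const 2).aestronglyMeasurable
      · refine integrable_of_bounded ((hvm s).pow_const 2) (C := Real.exp (K * T) ^ 2) fun x => ?_
        rw [abs_pow]
        gcongr
        exact hvb T hT0 s (by linarith [le_abs_self s]) x
      · exact (((hvm s).const_mul 2).mul (hdm s)).aestronglyMeasurable
      · refine ae_of_all _ fun x r hr => ?_
        have hr' : r + ε ≤ T := by linarith [mem_Iio.1 hr]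
        rw [Real.norm_eq_abs, abs_mul, abs_mul, abs_two]
        gcongr
        · exact hvb T hT0 r hr' x
        · exact hdb T hT0 r hr' x
      · exact integrable_const _
      · refine ae_of_all _ fun x r _ => ?_
        have h1 := (hvd r x).pow 2
        simp only [Nat.cast_ofNat, Nat.add_one_sub_one, pow_one] at h1
        exact h1
    -- The time derivative is `d = g + W v`, with `g` the image of `v` under the generator, so `∫ v
    -- d` is exactly the form controlled by `hΛ`.
    have hle : ∀ s, 0 ≤ s → ∫ x, 2 * v s x * d s x ∂μ ≤ 2 * Λ * ∫ x, v s x ^ 2 ∂μ := by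
      intro s hs
      have hb := hvb (s + ε) (by linarith) s le_rfl
      have hb' := hdb (s + ε) (by linarith) s le_rfl
      have h1 := hΛ (v s) (fun x => d s x - W x * v s x) (hvm s) ⟨_, hb⟩ (by
        rw [hv, hd]; exact M.generatorGraph_feynmanKacAverage hcont hW hε hs)
      have i1 : Integrable (fun x => W x * v s x ^ 2) μ := by
        refine integrable_of_bounded (hW.measurable.mul ((hvm s).pow_const 2))
          (C := K * Real.exp (K * (s + ε)) ^ 2) fun x => ?_
        rw [abs_mul, abs_pow, abs_of_nonneg (hW.nonneg x)]
        gcongr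
        · exact hW.le x
        · exact hb x
      have i2 : Integrable (fun x => d s x * v s x) μ := by
        refine integrable_of_bounded ((hdm s).mul (hvm s)) (C := Real.exp (K * (s + ε)) * K *
          Real.exp (K * (s + ε))) fun x => ?_
        rw [abs_mul]
        gcongr
        · exact hb' x
        · exact hb x
      have e1 : ∫ x, (d s x - W x * v s x) * v s x ∂μ =
          (∫ x, d s x * v s x ∂μ) - ∫ x, W x * v s x ^ 2 ∂μ := by
        rw [← integral_sub i2 i1]
        refine integral_congr_ae (ae_of_all _ fun x => ?_)
        simp only
        ring
      have e2 : ∫ x, 2 * v s x * d s x ∂μ = 2 * ∫ x, d s x * v s x ∂μ := by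
        rw [← integral_const_mul]
        refine integral_congr_ae (ae_of_all _ fun x => ?_)
        simp only
        ring
      rw [e1] at h1
      rw [e2]
      linarith
    have hψ : ∀ s, HasDerivAt (fun s => Real.exp (-(2 * Λ * s)) * ∫ x, v s x ^ 2 ∂μ)
        (Real.exp (-(2 * Λ * s)) * -(2 * Λ) * (∫ x, v s x ^ 2 ∂μ) +
          Real.exp (-(2 * Λ * s)) * ∫ x, 2 * v s x * d s x ∂μ) s := by
      intro s
      have h1 : HasDerivAt (fun s => Real.exp (-(2 * Λ * s)))
          (Real.exp (-(2 * Λ * s)) * -(2 * Λ)) s := by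
        have := (((hasDerivAt_id s).const_mul (2 * Λ)).neg).exp
        simpa using this
      exact h1.mul (hφ s)
    -- Gronwall's argument: the derivative of `exp(-2Λs) ‖v_s‖²` is nonpositive.
    have hanti : AntitoneOn (fun s => Real.exp (-(2 * Λ * s)) * ∫ x, v s x ^ 2 ∂μ) (Ici 0) := by
      refine antitoneOn_of_deriv_nonpos (convex_Ici 0)
        (fun s _ => (hψ s).continuousAt.continuousWithinAt)
        (fun s _ => (hψ s).differentiableAt.differentiableWithinAt) fun s hs => ?_
      rw [interior_Ici, mem_Ioi] at hs
      rw [(hψ s).deriv]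
      have := mul_le_mul_of_nonneg_left (hle s hs.le) (Real.exp_nonneg (-(2 * Λ * s)))
      linarith
    have h0 := hanti (mem_Ici.2 le_rfl) (mem_Ici.2 ht) ht
    simp only [mul_zero, neg_zero, Real.exp_zero, one_mul] at h0
    have h1 : ∫ x, v 0 x ^ 2 ∂μ ≤ Real.exp (K * ε) ^ 2 := by
      refine (le_abs_self _).trans (abs_integral_le_of_bounded fun x => ?_)
      rw [abs_pow]
      gcongr
      exact hvb ε hε.le 0 (by simp) x
    have h2 : ∫ x, M.feynmanKac W t x ^ 2 ∂μ ≤ ∫ x, v t x ^ 2 ∂μ := by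
      refine integral_mono (integrable_of_bounded ((M.measurable_feynmanKac hW.measurable
        t).pow_const 2) (C := Real.exp (K * t) ^ 2) fun x => ?_)
        (integrable_of_bounded ((hvm t).pow_const 2) (C := Real.exp (K * (t + ε)) ^ 2)
        fun x => ?_) fun x => ?_
      · rw [abs_pow]
        gcongr
        exact M.abs_feynmanKac_le hW le_rfl ht x
      · rw [abs_pow]
        gcongr
        exact hvb (t + ε) (by linarith) t le_rfl x
      · refine pow_le_pow_left₀ (M.feynmanKac_nonneg W t x) ?_ 2
        rw [hv]
        exact M.feynmanKac_le_average hW hε t x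
    have h3 : Real.exp (2 * Λ * t) * Real.exp (-(2 * Λ * t)) = 1 := by
      rw [← Real.exp_add]; simp
    calc _ ≤ ∫ x, v t x ^ 2 ∂μ := h2
      _ = Real.exp (2 * Λ * t) * (Real.exp (-(2 * Λ * t)) * ∫ x, v t x ^ 2 ∂μ) := by
          rw [← mul_assoc, h3, one_mul]
      _ ≤ Real.exp (2 * Λ * t) * Real.exp (K * ε) ^ 2 :=
          mul_le_mul_of_nonneg_left (h0.trans h1) (Real.exp_nonneg _)
      _ = _ := mul_comm _ _
  have hlim : Tendsto (fun ε : ℝ => Real.exp (K * ε) ^ 2 * Real.exp (2 * Λ * t)) (𝓝[>] 0)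
      (𝓝 (Real.exp (2 * Λ * t))) := by
    have : Continuous fun ε : ℝ => Real.exp (K * ε) ^ 2 * Real.exp (2 * Λ * t) := by fun_prop
    have h := (this.tendsto 0).mono_left (nhdsWithin_le_nhds (s := Ioi 0))
    simpa using h
  exact ge_of_tendsto hlim (eventually_nhdsWithin_of_forall main)

end MarkovProcess

/-! ### Convex duality for `F` -/

/-- The slope is the supremum of the chord slopes to the right of `J`; by concavity every chord
slope to the left dominates all of these. -/
theorem ConcaveOn.exists_supergradient {F : ℝ → ℝ} (hF : ConcaveOn ℝ (Ioi 0) F) {J : ℝ}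
    (hJ : 0 < J) : ∃ c, ∀ y, 0 < y → F y ≤ F J + c * (y - J) := by
  have hslope : ∀ x z, 0 < x → x < J → J < z →
      (F z - F J) / (z - J) ≤ (F J - F x) / (J - x) := fun x z hx hxJ hJz =>
    hF.slope_anti_adjacent hx (hJ.trans hJz : (0 : ℝ) < z) hxJ hJz
  have hbdd : BddAbove ((fun z => (F z - F J) / (z - J)) '' Ioi J) := by
    refine ⟨(F J - F (J / 2)) / (J - J / 2), ?_⟩
    rintro _ ⟨z, hz, rfl⟩
    exact hslope _ z (by linarith) (by linarith) hz
  refine ⟨sSup ((fun z => (F z - F J) / (z - J)) '' Ioi J), fun y hy => ?_⟩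
  rcases lt_trichotomy y J with h | rfl | h
  · have h1 : sSup ((fun z => (F z - F J) / (z - J)) '' Ioi J) ≤ (F J - F y) / (J - y) := by
      refine csSup_le (nonempty_Ioi.image _) ?_
      rintro _ ⟨z, hz, rfl⟩
      exact hslope y z hy h hz
    rw [le_div_iff₀ (by linarith)] at h1
    linarith
  · simp
  · have h1 : (F y - F J) / (y - J) ≤ sSup ((fun z => (F z - F J) / (z - J)) '' Ioi J) :=
      le_csSup hbdd ⟨y, h, rfl⟩
    rw [div_le_iff₀ (by linarith)] at h1
    linarith

namespace IsSobolevFunction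

variable {F : ℝ → ℝ}

theorem exists_eq (hF : IsSobolevFunction F) {w : ℝ} (hw : 0 ≤ w) : ∃ y ∈ Ioi (0 : ℝ), F y = w := by
  obtain ⟨b, hb, hb1⟩ := ((hF.tendsto_atTop.eventually_ge_atTop w).and
    (eventually_ge_atTop 1)).exists
  have hsub : Icc 1 b ⊆ Ioi (0 : ℝ) := fun y hy => zero_lt_one.trans_le hy.1
  obtain ⟨y, hy, hyw⟩ := intermediate_value_Icc hb1 (hF.continuousOn.mono hsub)
    (⟨by rw [hF.map_one]; exact hw, hb⟩ : w ∈ Icc (F 1) (F b))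
  exact ⟨y, hsub hy, hyw⟩

theorem sobolevInv_pos (hF : IsSobolevFunction F) {w : ℝ} (hw : 0 ≤ w) : 0 < sobolevInv F w :=
  Function.invFunOn_mem (hF.exists_eq hw)

theorem apply_sobolevInv (hF : IsSobolevFunction F) {w : ℝ} (hw : 0 ≤ w) :
    F (sobolevInv F w) = w :=
  Function.invFunOn_eq (hF.exists_eq hw)

theorem sobolevInv_mono (hF : IsSobolevFunction F) {w w' : ℝ} (hw : 0 ≤ w) (h : w ≤ w') :
    sobolevInv F w ≤ sobolevInv F w' := by
  rw [← hF.strictMonoOn.le_iff_le (hF.sobolevInv_pos hw) (hF.sobolevInv_pos (hw.trans h)),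
    hF.apply_sobolevInv hw, hF.apply_sobolevInv (hw.trans h)]
  exact h

theorem sobolevInv_zero (hF : IsSobolevFunction F) : sobolevInv F 0 = 1 :=
  hF.strictMonoOn.injOn (hF.sobolevInv_pos le_rfl) (zero_lt_one : (0 : ℝ) < 1)
    (by rw [hF.apply_sobolevInv le_rfl, hF.map_one])

theorem one_le_sobolevInv (hF : IsSobolevFunction F) {w : ℝ} (hw : 0 ≤ w) :
    1 ≤ sobolevInv F w :=
  hF.sobolevInv_zero ▸ hF.sobolevInv_mono le_rfl hw

theorem measurable_sobolevInv_comp (hF : IsSobolevFunction F) {E : Type*} [MeasurableSpace E]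
    {U : E → ℝ} (hU : Measurable U) (hU0 : ∀ x, 0 ≤ U x) :
    Measurable fun x => sobolevInv F (U x) := by
  have hmono : Monotone fun w => sobolevInv F (max w 0) := fun a b h =>
    hF.sobolevInv_mono (le_max_right _ _) (max_le_max_right 0 h)
  have h := hmono.measurable.comp hU
  simp only [Function.comp_def, max_eq_left (hU0 _)] at h
  exact h

/-- The entropic inequality dual to the `F`-Sobolev inequality. -/
theorem integral_mul_sq_le (hF : IsSobolevFunction F) {E : Type*} [MeasurableSpace E]
    {μ : Measure E} [IsProbabilityMeasure μ] {k B U : E → ℝ} {a : ℝ}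
    (hk2 : Integrable (fun x => k x ^ 2) μ) (hk1 : ∫ x, k x ^ 2 ∂μ = 1)
    (hkF : Integrable (fun x => k x ^ 2 * F (k x ^ 2)) μ)
    (hBk : Integrable (fun x => B x * k x ^ 2) μ) (hU0 : ∀ x, 0 ≤ U x)
    (hUint : Integrable (fun x => sobolevInv F (U x)) μ) (hBU : ∀ x, B x ≤ a + U x / 2) :
    ∫ x, B x * k x ^ 2 ∂μ ≤
      a + (F (∫ x, sobolevInv F (U x) ∂μ) + ∫ x, k x ^ 2 * F (k x ^ 2) ∂μ) / 2 := by
  obtain ⟨J, hJ⟩ : ∃ J, J = ∫ x, sobolevInv F (U x) ∂μ := ⟨_, rfl⟩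
  have hJ1 : 1 ≤ J := by
    rw [hJ]
    calc (1 : ℝ) = ∫ _, 1 ∂μ := by simp
      _ ≤ _ := integral_mono (integrable_const _) hUint fun x => hF.one_le_sobolevInv (hU0 x)
  obtain ⟨c, hc⟩ := hF.concaveOn.exists_supergradient (zero_lt_one.trans_le hJ1)
  -- Monotonicity of `F` gives `c ≥ 0`, which is needed at the points where `k` vanishes.
  have hc0 : 0 ≤ c := by
    have h1 := hc (J + 1) (by linarith)
    have h2 := hF.strictMonoOn (show J ∈ Ioi (0 : ℝ) from zero_lt_one.trans_le hJ1)
      (show J + 1 ∈ Ioi (0 : ℝ) from by simp only [mem_Ioi]; linarith) (by linarith)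
    linarith
  -- With `y = F⁻¹(U)`, subadditivity gives `U = F((y/k²) k²) ≤ F(y/k²) + F(k²)`, and the
  -- supergradient at `J` linearises `F(y/k²)`. Upon integration the terms in `c` cancel because `∫
  -- k² = 1` and `∫ y = J`. This is Jensen's inequality for `k² μ` in pointwise form.
  have hpt : ∀ x, B x * k x ^ 2 ≤ (a + (F J - c * J) / 2) * k x ^ 2 +
      c / 2 * sobolevInv F (U x) + 1 / 2 * (k x ^ 2 * F (k x ^ 2)) := by
    intro x
    have hy := hF.sobolevInv_pos (hU0 x)
    have h1 : B x * k x ^ 2 ≤ a * k x ^ 2 + k x ^ 2 * U x / 2 := by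
      have := mul_le_mul_of_nonneg_right (hBU x) (sq_nonneg (k x))
      linarith
    have h2 : k x ^ 2 * U x ≤ (F J - c * J) * k x ^ 2 + c * sobolevInv F (U x) +
        k x ^ 2 * F (k x ^ 2) := by
      by_cases hk : k x = 0
      · rw [hk]
        have : 0 ≤ c * sobolevInv F (U x) := mul_nonneg hc0 hy.le
        simpa using this
      · have hkpos : 0 < k x ^ 2 := by positivity
        have h3 := hF.map_mul_le (sobolevInv F (U x) / k x ^ 2) (k x ^ 2) (by positivity) hkpos
        rw [div_mul_cancel₀ _ hkpos.ne', hF.apply_sobolevInv (hU0 x)] at h3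
        have h4 := hc (sobolevInv F (U x) / k x ^ 2) (by positivity)
        have h5 := mul_le_mul_of_nonneg_left (h3.trans (add_le_add h4 le_rfl)) hkpos.le
        refine h5.trans (le_of_eq ?_)
        field_simp
        ring
    linarith
  have i1 : Integrable (fun x => (a + (F J - c * J) / 2) * k x ^ 2) μ := hk2.const_mul _
  have i2 : Integrable (fun x => c / 2 * sobolevInv F (U x)) μ := hUint.const_mul _
  have i3 : Integrable (fun x => 1 / 2 * (k x ^ 2 * F (k x ^ 2))) μ := hkF.const_mul _
  have h := integral_mono hBk ((i1.add i2).add i3) hpt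
  rw [integral_add' (i1.add i2) i3, integral_add' i1 i2, integral_const_mul, integral_const_mul,
    integral_const_mul, hk1, ← hJ] at h
  rw [← hJ]
  linarith

end IsSobolevFunction

/-! ### The form bound for `L + B` -/

theorem integral_linear_combination {E : Type*} [MeasurableSpace E] {μ : Measure E}
    {f₁ f₂ f₃ : E → ℝ} (h₁ : Integrable f₁ μ) (h₂ : Integrable f₂ μ) (h₃ : Integrable f₃ μ)
    (c₁ c₂ c₃ : ℝ) : ∫ x, c₁ * f₁ x + c₂ * f₂ x + c₃ * f₃ x ∂μ =
      c₁ * ∫ x, f₁ x ∂μ + c₂ * ∫ x, f₂ x ∂μ + c₃ * ∫ x, f₃ x ∂μ := by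
  have h := integral_add ((h₁.const_mul c₁).add (h₂.const_mul c₂)) (h₃.const_mul c₃)
  have h' := integral_add (h₁.const_mul c₁) (h₂.const_mul c₂)
  simp only [Pi.add_apply] at h
  rw [h, h', integral_const_mul, integral_const_mul, integral_const_mul]

theorem sq_integral_mul_le {E : Type*} [MeasurableSpace E] {μ : Measure E} {B h : E → ℝ}
    (hB : Integrable (fun x => B x ^ 2) μ) (hh : Integrable (fun x => h x ^ 2) μ)
    (hBh : Integrable (fun x => B x * h x) μ) :
    (∫ x, B x * h x ∂μ) ^ 2 ≤ (∫ x, B x ^ 2 ∂μ) * ∫ x, h x ^ 2 ∂μ := by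
  have key : ∀ t : ℝ, 0 ≤ (∫ x, B x ^ 2 ∂μ) * (t * t) + (2 * ∫ x, B x * h x ∂μ) * t +
      ∫ x, h x ^ 2 ∂μ := by
    intro t
    have h0 : 0 ≤ ∫ x, (t * B x + h x) ^ 2 ∂μ := integral_nonneg fun x => sq_nonneg _
    have e : ∀ x, (t * B x + h x) ^ 2 = (t * t) * B x ^ 2 + (2 * t) * (B x * h x) + 1 * h x ^ 2 :=
      fun x => by ring
    simp_rw [e] at h0
    rw [integral_linear_combination hB hBh hh] at h0
    linarith
  have h := discrim_le_zero key
  rw [discrim] at h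
  linarith

namespace MarkovProcess

variable {E Ω : Type*} [MeasurableSpace E] [MeasurableSpace Ω] (M : MarkovProcess E Ω)

theorem semigroup_affine (t : ℝ≥0) {f : E → ℝ} (hf : Measurable f) {C : ℝ}
    (hC : ∀ x, |f x| ≤ C) (c a : ℝ) (x : E) :
    M.semigroup t (fun y => c * (f y - a)) x = c * (M.semigroup t f x - a) := by
  simp only [semigroup]
  rw [integral_const_mul, integral_sub (integrable_of_bounded hf hC) (integrable_const _)]
  simp

/-- Constants are fixed by the semigroup, since the process is conservative. Hence a centred and
normalised `f` stays in the domain, as the `F`-Sobolev inequality requires. -/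
theorem GeneratorGraph.affine {M : MarkovProcess E Ω} {μ : Measure E} [IsProbabilityMeasure μ]
    {f g : E → ℝ} (h : M.GeneratorGraph μ f g) (hf : Measurable f) {C : ℝ}
    (hC : ∀ x, |f x| ≤ C) (c a : ℝ) :
    M.GeneratorGraph μ (fun x => c * (f x - a)) fun x => c * g x := by
  refine ⟨(h.1.sub (memLp_const a)).const_mul c, h.2.1.const_mul c, ?_⟩
  have heq : ∀ t : ℝ≥0, eLpNorm (fun x => (t : ℝ)⁻¹ * (M.semigroup t (fun y => c * (f y - a)) x -
      c * (f x - a)) - c * g x) 2 μ =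
      ‖c‖ₑ * eLpNorm (fun x => (t : ℝ)⁻¹ * (M.semigroup t f x - f x) - g x) 2 μ := by
    intro t
    rw [← eLpNorm_const_smul]
    congr 1
    ext x
    rw [M.semigroup_affine t hf hC, Pi.smul_apply, smul_eq_mul]
    ring
  simp_rw [heq]
  have := ENNReal.Tendsto.const_mul h.2.2 (Or.inr (enorm_ne_top (x := c)))
  simpa using this

theorem integral_semigroup {μ : Measure E} [IsProbabilityMeasure μ] (hinv : M.IsInvariant μ)
    (t : ℝ≥0) {f : E → ℝ} (hf : Measurable f) {C : ℝ} (hC : ∀ x, |f x| ≤ C) :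
    ∫ x, M.semigroup t f x ∂μ = ∫ x, f x ∂μ := by
  have h : (M.transition t) ∘ₘ μ = μ := hinv t
  rw [Measure.comp_eq_comp_const_apply] at h
  conv_rhs => rw [← h]
  rw [Kernel.integral_comp (by rw [h]; exact integrable_of_bounded hf hC)]
  rfl

/-- By invariance `P_t f - f` has mean zero, so `|∫ g dμ|` is at most the `L²` distance from the
difference quotient to `g`, which tends to `0`. -/
theorem GeneratorGraph.integral_eq_zero {M : MarkovProcess E Ω} {μ : Measure E}
    [IsProbabilityMeasure μ] (hinv : M.IsInvariant μ) {f g : E → ℝ}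
    (h : M.GeneratorGraph μ f g) (hf : Measurable f) {C : ℝ} (hC : ∀ x, |f x| ≤ C) :
    ∫ x, g x ∂μ = 0 := by
  have hg : Integrable g μ := h.2.1.integrable one_le_two
  have hle : ∀ t : ℝ≥0, ‖∫ x, g x ∂μ‖ₑ ≤
      eLpNorm (fun x => (t : ℝ)⁻¹ * (M.semigroup t f x - f x) - g x) 2 μ := by
    intro t
    have hP : Integrable (fun x => M.semigroup t f x) μ :=
      integrable_of_bounded (M.measurable_semigroup t hf) (M.abs_semigroup_le t hC)
    have hfi : Integrable f μ := integrable_of_bounded hf hC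
    have hi : Integrable (fun x => (t : ℝ)⁻¹ * (M.semigroup t f x - f x)) μ :=
      (hP.sub hfi).const_mul _
    have e : ∫ x, ((t : ℝ)⁻¹ * (M.semigroup t f x - f x) - g x) ∂μ = -∫ x, g x ∂μ := by
      rw [integral_sub hi hg, integral_const_mul, integral_sub hP hfi,
        M.integral_semigroup hinv t hf hC]
      simp
    calc ‖∫ x, g x ∂μ‖ₑ = ‖∫ x, ((t : ℝ)⁻¹ * (M.semigroup t f x - f x) - g x) ∂μ‖ₑ := by
          rw [e, enorm_neg]
      _ ≤ eLpNorm (fun x => (t : ℝ)⁻¹ * (M.semigroup t f x - f x) - g x) 1 μ := by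
          rw [eLpNorm_one_eq_lintegral_enorm]
          exact enorm_integral_le_lintegral_enorm _
      _ ≤ _ := eLpNorm_le_eLpNorm_of_exponent_le one_le_two (hi.sub hg).aestronglyMeasurable
  have h0 := ge_of_tendsto h.2.2 (Eventually.of_forall hle)
  simpa using h0

/-- The bound on the quadratic form of `L + B` for a bounded potential `B`. -/
theorem form_le {M : MarkovProcess E Ω} {μ : Measure E} [IsProbabilityMeasure μ]
    (hinv : M.IsInvariant μ) {F : ℝ → ℝ} (hF : IsSobolevFunction F) (hSob : M.FSobolev μ F)
    {C : ℝ} (hC : 0 < C) (hPoinc : M.Poincare μ C) {B U : E → ℝ} (hB : Measurable B) {K : ℝ}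
    (hBK : ∀ x, |B x| ≤ K) {q : ℝ} (hBq : ∫ x, B x ^ 2 ∂μ ≤ q) (hU0 : ∀ x, 0 ≤ U x)
    (hUint : Integrable (fun x => sobolevInv F (U x)) μ)
    (hUF : F (∫ x, sobolevInv F (U x) ∂μ) ≤ 1 / (4 * C))
    (hBU : ∀ x, B x ≤ 1 / (4 * C) + U x / 2) {f g : E → ℝ} (hf : Measurable f)
    (hfb : ∃ D, ∀ x, |f x| ≤ D) (hfg : M.GeneratorGraph μ f g) :
    ∫ x, B x * f x ^ 2 ∂μ + ∫ x, g x * f x ∂μ ≤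
      (8 * C * q + |∫ x, B x ∂μ|) * ∫ x, f x ^ 2 ∂μ := by
  obtain ⟨D, hD⟩ := hfb
  have hgi : Integrable g μ := hfg.2.1.integrable one_le_two
  have hfi : Integrable f μ := integrable_of_bounded hf hD
  have hBi : Integrable B μ := integrable_of_bounded hB hBK
  have hB2i : Integrable (fun x => B x ^ 2) μ := hBi.bdd_mul hB.aestronglyMeasurable
    (ae_of_all _ hBK) |>.congr (ae_of_all _ fun x => by simp only; ring)
  have hg0 := hfg.integral_eq_zero hinv hf hD
  have hq0 : 0 ≤ q := (integral_nonneg fun x => sq_nonneg _).trans hBq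
  have hK0 : 0 ≤ K := by
    obtain ⟨x⟩ : Nonempty E := nonempty_of_isProbabilityMeasure μ
    exact (abs_nonneg _).trans (hBK x)
  obtain ⟨a, ha⟩ : ∃ a, a = ∫ x, f x ∂μ := ⟨_, rfl⟩
  obtain ⟨h, hh⟩ : ∃ h : E → ℝ, h = fun x => f x - a := ⟨_, rfl⟩
  have hhm : Measurable h := hh ▸ hf.sub_const a
  have hhD : ∀ x, |h x| ≤ D + |a| := fun x => by
    rw [hh]; exact (abs_sub _ _).trans (add_le_add (hD x) le_rfl)
  have hhi : Integrable h μ := integrable_of_bounded hhm hhD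
  have hh2i : Integrable (fun x => h x ^ 2) μ := hhi.bdd_mul hhm.aestronglyMeasurable
    (ae_of_all _ hhD) |>.congr (ae_of_all _ fun x => by simp only; ring)
  have hBhi : Integrable (fun x => B x * h x) μ :=
    hhi.bdd_mul hB.aestronglyMeasurable (ae_of_all _ hBK)
  have hBh2i : Integrable (fun x => B x * h x ^ 2) μ :=
    hh2i.bdd_mul hB.aestronglyMeasurable (ae_of_all _ hBK)
  have hgfi : Integrable (fun x => g x * f x) μ :=
    (hgi.bdd_mul hf.aestronglyMeasurable (ae_of_all _ hD)).congr
      (ae_of_all _ fun x => mul_comm _ _)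
  obtain ⟨S, hS⟩ : ∃ S, S = ∫ x, h x ^ 2 ∂μ := ⟨_, rfl⟩
  obtain ⟨e, he⟩ : ∃ e, e = -∫ x, g x * f x ∂μ := ⟨_, rfl⟩
  have hS0 : 0 ≤ S := hS ▸ integral_nonneg fun x => sq_nonneg _
  have hSe : S ≤ C * e := by
    have h1 := hPoinc f g hfg
    rw [variance_eq_integral hf.aemeasurable, ← ha] at h1
    rw [hS, he, hh]
    linarith
  have he0 : 0 ≤ e := by
    by_contra! hneg
    nlinarith
  have hf2 : ∫ x, f x ^ 2 ∂μ = a ^ 2 + S := by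
    have e1 : ∀ x, f x ^ 2 = 1 * h x ^ 2 + (2 * a) * f x + (-a ^ 2) * 1 := fun x => by
      rw [hh]; ring
    simp_rw [e1]
    rw [integral_linear_combination hh2i hfi (integrable_const 1), ← ha, ← hS, integral_const,
      probReal_univ, one_smul]
    ring
  have hBf : ∫ x, B x * f x ^ 2 ∂μ = a ^ 2 * ∫ x, B x ∂μ + 2 * a * ∫ x, B x * h x ∂μ +
      ∫ x, B x * h x ^ 2 ∂μ := by
    have e1 : ∀ x, B x * f x ^ 2 = a ^ 2 * B x + 2 * a * (B x * h x) + 1 * (B x * h x ^ 2) :=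
      fun x => by rw [hh]; ring
    simp_rw [e1]
    rw [integral_linear_combination hBi hBhi hBh2i, one_mul]
  -- If `S = 0`, the integral is at most `K S = 0`. Otherwise the entropic inequality for `k = h /
  -- √S` gives the bound `3/8 (S/C) + e/2`, and Poincaré gives `S/C ≤ e`.
  have hquad : ∫ x, B x * h x ^ 2 ∂μ ≤ 7 / 8 * e := by
    rcases hS0.eq_or_lt with hS1 | hS1
    · have h1 : ∫ x, B x * h x ^ 2 ∂μ ≤ ∫ x, K * h x ^ 2 ∂μ :=
        integral_mono hBh2i (hh2i.const_mul K) fun x =>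
          mul_le_mul_of_nonneg_right ((le_abs_self _).trans (hBK x)) (sq_nonneg _)
      rw [integral_const_mul, ← hS, ← hS1, mul_zero] at h1
      linarith
    · obtain ⟨σ, hσ⟩ : ∃ σ, σ = (Real.sqrt S)⁻¹ := ⟨_, rfl⟩
      have hσ2 : σ ^ 2 = S⁻¹ := by rw [hσ, inv_pow, Real.sq_sqrt hS0]
      have hk := hfg.affine hf hD σ a
      have hkh : (fun x => σ * (f x - a)) = fun x => σ * h x := by rw [hh]
      rw [hkh] at hk
      have hk1 : ∫ x, (σ * h x) ^ 2 ∂μ = 1 := by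
        simp_rw [mul_pow]
        rw [integral_const_mul, ← hS, hσ2, inv_mul_cancel₀ hS1.ne']
      obtain ⟨hkF, hkE⟩ := hSob _ _ hk hk1
      have hk2i : Integrable (fun x => (σ * h x) ^ 2) μ := by
        simp_rw [mul_pow]; exact hh2i.const_mul _
      have eB : ∀ x, B x * (σ * h x) ^ 2 = σ ^ 2 * (B x * h x ^ 2) := fun x => by ring
      have hBk : Integrable (fun x => B x * (σ * h x) ^ 2) μ := by
        simp_rw [eB]; exact hBh2i.const_mul _
      have key := hF.integral_mul_sq_le hk2i hk1 hkF hBk hU0 hUint hBU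
      have eE : ∫ x, σ * g x * (σ * h x) ∂μ = -(σ ^ 2 * e) := by
        have e1 : ∀ x, σ * g x * (σ * h x) = σ ^ 2 * (g x * f x) - σ ^ 2 * a * g x :=
          fun x => by rw [hh]; ring
        simp_rw [e1]
        rw [integral_sub (hgfi.const_mul _) (hgi.const_mul _), integral_const_mul,
          integral_const_mul, hg0, he]
        ring
      rw [eE] at hkE
      simp_rw [eB] at key
      rw [integral_const_mul, hσ2] at key
      rw [hσ2] at hkE
      have h1 : S⁻¹ * ∫ x, B x * h x ^ 2 ∂μ ≤ 1 / (4 * C) + (1 / (4 * C) + S⁻¹ * e) / 2 := by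
        linarith
      rw [inv_mul_le_iff₀ hS1] at h1
      have h2 : S * (1 / (4 * C) + (1 / (4 * C) + S⁻¹ * e) / 2) = 3 / 8 * (S / C) + e / 2 := by
        field_simp
        ring
      have h3 : S / C ≤ e := by rw [div_le_iff₀ hC]; linarith
      linarith
  -- Cauchy-Schwarz and `S ≤ C e` bound this by `2|a| √(q C e)`. That is twice the geometric mean of
  -- `8 C q a²` and `e/8`, the weights being chosen to spend the energy left by `hquad`.
  have hcross : 2 * a * ∫ x, B x * h x ∂μ ≤ 8 * C * q * a ^ 2 + e / 8 := by
    have h1 := sq_integral_mul_le hB2i hh2i hBhi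
    rw [← hS] at h1
    have h2 : (∫ x, B x * h x ∂μ) ^ 2 ≤ q * (C * e) :=
      h1.trans (mul_le_mul hBq hSe hS0 hq0)
    refine abs_le_of_sq_le_sq' ?_ (by positivity) |>.2
    have h3 : (2 * a * ∫ x, B x * h x ∂μ) ^ 2 ≤ 4 * a ^ 2 * (q * (C * e)) := by
      rw [mul_pow, mul_pow]
      have := mul_le_mul_of_nonneg_left h2 (by positivity : (0 : ℝ) ≤ 2 ^ 2 * a ^ 2)
      linarith
    nlinarith [sq_nonneg (8 * C * q * a ^ 2 - e / 8)]
  have hmean : a ^ 2 * ∫ x, B x ∂μ ≤ a ^ 2 * |∫ x, B x ∂μ| :=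
    mul_le_mul_of_nonneg_left (le_abs_self _) (sq_nonneg a)
  have hfin : 0 ≤ (8 * C * q + |∫ x, B x ∂μ|) * S := by positivity
  rw [hBf, hf2]
  linarith

end MarkovProcess

/-! ### The truncated potential and positivity of `λ₁` -/

section TruncatedPotential

variable {E : Type*} {V : E → ℝ} {C l l' : ℝ}

theorem truncatedPotential_nonneg (hC : 0 < C) (x : E) : 0 ≤ truncatedPotential V C l x := by
  refine indicator_nonneg (fun y hy => ?_) x
  have h1 : 0 < l * V y := lt_trans (by positivity) (show 1 / (4 * C) < l * V y from hy)
  linarith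

theorem truncatedPotential_mono (hC : 0 < C) (hl : 0 < l) (h : l ≤ l') (x : E) :
    truncatedPotential V C l x ≤ truncatedPotential V C l' x := by
  by_cases hx : 1 / (4 * C) < l * V x
  · have h0 : 0 < l * V x := lt_trans (by positivity) hx
    have hV : 0 < V x := pos_of_mul_pos_right h0 hl.le
    have h1 : l * V x ≤ l' * V x := mul_le_mul_of_nonneg_right h hV.le
    rw [truncatedPotential, truncatedPotential, indicator_of_mem (by exact hx),
      indicator_of_mem (by exact hx.trans_le h1)]
    linarith
  · rw [truncatedPotential, indicator_of_notMem (by exact hx)]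
    exact truncatedPotential_nonneg hC x

theorem mul_posPart_le_truncatedPotential (hC : 0 < C) (x : E) :
    l * max (V x) 0 ≤ 1 / (4 * C) + truncatedPotential V C l x / 2 := by
  have hC' : 0 < 1 / (4 * C) := by positivity
  rcases le_total (V x) 0 with hV | hV
  · rw [max_eq_right hV, mul_zero]
    linarith [truncatedPotential_nonneg (V := V) (l := l) hC x]
  · rw [max_eq_left hV]
    by_cases hx : 1 / (4 * C) < l * V x
    · rw [truncatedPotential, indicator_of_mem (by exact hx)]
      linarith
    · rw [truncatedPotential, indicator_of_notMem (by exact hx)]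
      linarith

theorem truncatedPotential_le (hl : 0 < l) (h : 2 * l ≤ l') (x : E) :
    truncatedPotential V C l x ≤ l' * max (V x) 0 := by
  have h0 : 0 ≤ l' * max (V x) 0 := mul_nonneg (by linarith) (le_max_right _ _)
  refine indicator_apply_le' (fun _ => ?_) fun _ => h0
  calc 2 * l * V x ≤ 2 * l * max (V x) 0 := by gcongr; exact le_max_left _ _
    _ ≤ _ := by gcongr

theorem measurable_truncatedPotential [MeasurableSpace E] (hV : Measurable V) :
    Measurable (truncatedPotential V C l) :=
  (hV.const_mul _).indicator (measurableSet_lt measurable_const (hV.const_mul _))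

end TruncatedPotential

section LambdaOne

variable {E : Type*} [MeasurableSpace E] {μ : Measure E} [IsProbabilityMeasure μ] {F : ℝ → ℝ}
  {V : E → ℝ} {C l₀ : ℝ}

/-- The set of admissible `l` in the definition of `λ₁`. -/
def admissible (μ : Measure E) (F : ℝ → ℝ) (V : E → ℝ) (C l₀ : ℝ) : Set ℝ :=
  {l : ℝ | 0 < l ∧ l ≤ l₀ ∧ Integrable (fun x => sobolevInv F (truncatedPotential V C l x)) μ ∧
    F (∫ x, sobolevInv F (truncatedPotential V C l x) ∂μ) ≤ 1 / (4 * C)}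

theorem IsSobolevFunction.one_le_integral (hF : IsSobolevFunction F) {U : E → ℝ}
    (hU0 : ∀ x, 0 ≤ U x) (hU : Integrable (fun x => sobolevInv F (U x)) μ) :
    1 ≤ ∫ x, sobolevInv F (U x) ∂μ := by
  calc (1 : ℝ) = ∫ _, 1 ∂μ := by simp
    _ ≤ _ := integral_mono (integrable_const _) hU fun x => hF.one_le_sobolevInv (hU0 x)

theorem integrable_sobolevInv_of_le {μ : Measure E} (hF : IsSobolevFunction F) {U U' : E → ℝ} (hUm : Measurable U)
    (hU0 : ∀ x, 0 ≤ U x) (hle : ∀ x, U x ≤ U' x)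
    (hU' : Integrable (fun x => sobolevInv F (U' x)) μ) :
    Integrable (fun x => sobolevInv F (U x)) μ := by
  refine hU'.mono' (hF.measurable_sobolevInv_comp hUm hU0).aestronglyMeasurable
    (ae_of_all _ fun x => ?_)
  rw [Real.norm_eq_abs, abs_of_pos (hF.sobolevInv_pos (hU0 x))]
  exact hF.sobolevInv_mono (hU0 x) (hle x)

/-- The truncated potential increases with `l`, so the admissible set is an interval with left end
`0`, and every `l` in `(0, λ₁)` is admissible. -/
theorem admissible_of_le (hF : IsSobolevFunction F) (hC : 0 < C) (hV : Measurable V) {l l' : ℝ}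
    (hl' : l' ∈ admissible μ F V C l₀) (hl : 0 < l) (h : l ≤ l') : l ∈ admissible μ F V C l₀ := by
  have hi := integrable_sobolevInv_of_le hF (measurable_truncatedPotential (C := C) (l := l) hV)
    (truncatedPotential_nonneg hC) (truncatedPotential_mono hC hl h) hl'.2.2.1
  refine ⟨hl, h.trans hl'.2.1, hi, le_trans ?_ hl'.2.2.2⟩
  have h1 := hF.one_le_integral (truncatedPotential_nonneg hC) hi
  have h2 : ∫ x, sobolevInv F (truncatedPotential V C l x) ∂μ ≤
      ∫ x, sobolevInv F (truncatedPotential V C l' x) ∂μ :=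
    integral_mono hi hl'.2.2.1 fun x =>
      hF.sobolevInv_mono (truncatedPotential_nonneg hC x) (truncatedPotential_mono hC hl h x)
  exact hF.strictMonoOn.monotoneOn (zero_lt_one.trans_le h1 : (0 : ℝ) < _)
    (zero_lt_one.trans_le (h1.trans h2) : (0 : ℝ) < _) h2

/-- As `l → 0` the truncated potential is eventually `0` at each point. Dominated convergence then
sends the integral to `F⁻¹(0) = 1`, where `F` vanishes. -/
theorem admissible_nonempty (hF : IsSobolevFunction F) (hC : 0 < C) (hV : Measurable V)
    (hl₀ : 0 < l₀) (hFV : Integrable (fun x => sobolevInv F (l₀ * max (V x) 0)) μ) :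
    (admissible μ F V C l₀).Nonempty := by
  -- The truncated potential carries a factor `2`, so starting from `l₀ / 2` keeps it below `l₀ V⁺`,
  -- which provides the dominating function.
  have hpos : ∀ n : ℕ, 0 < l₀ / 2 * (1 / ((n : ℝ) + 1)) := fun n => by positivity
  have hle : ∀ n : ℕ, l₀ / 2 * (1 / ((n : ℝ) + 1)) ≤ l₀ / 2 := fun n =>
    mul_le_of_le_one_right (by positivity) (by
      rw [div_le_one (by positivity)]; linarith [(Nat.cast_nonneg n : (0 : ℝ) ≤ n)])
  have hto : Tendsto (fun n : ℕ => l₀ / 2 * (1 / ((n : ℝ) + 1))) atTop (𝓝 0) := by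
    simpa using (tendsto_one_div_add_atTop_nhds_zero_nat (𝕜 := ℝ)).const_mul (l₀ / 2)
  have hbd : ∀ (n : ℕ) x, truncatedPotential V C (l₀ / 2 * (1 / ((n : ℝ) + 1))) x ≤
      l₀ * max (V x) 0 := fun n x => truncatedPotential_le (hpos n) (by linarith [hle n]) x
  have hm : ∀ n : ℕ, Measurable fun x =>
      sobolevInv F (truncatedPotential V C (l₀ / 2 * (1 / ((n : ℝ) + 1))) x) := fun n =>
    hF.measurable_sobolevInv_comp (measurable_truncatedPotential hV)
      (truncatedPotential_nonneg hC)
  have hlim : Tendsto (fun n : ℕ => ∫ x, sobolevInv F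
      (truncatedPotential V C (l₀ / 2 * (1 / ((n : ℝ) + 1))) x) ∂μ) atTop (𝓝 (∫ _, (1 : ℝ) ∂μ)) := by
    refine tendsto_integral_of_dominated_convergence (fun x => sobolevInv F (l₀ * max (V x) 0))
      (fun n => (hm n).aestronglyMeasurable) hFV (fun n => ae_of_all _ fun x => ?_)
      (ae_of_all _ fun x => ?_)
    · rw [Real.norm_eq_abs, abs_of_pos (hF.sobolevInv_pos (truncatedPotential_nonneg hC x))]
      exact hF.sobolevInv_mono (truncatedPotential_nonneg hC x) (hbd n x)
    · refine tendsto_const_nhds.congr' ?_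
      have h1 : Tendsto (fun n : ℕ => l₀ / 2 * (1 / ((n : ℝ) + 1)) * V x) atTop (𝓝 0) := by
        simpa using hto.mul_const (V x)
      filter_upwards [h1.eventually_lt_const (show (0 : ℝ) < 1 / (4 * C) by positivity)] with n hn
      rw [truncatedPotential, indicator_of_notMem (by exact not_lt.2 hn.le), hF.sobolevInv_zero]
  have hF1 : ContinuousAt F 1 := hF.continuousOn.continuousAt (Ioi_mem_nhds zero_lt_one)
  simp only [integral_const, probReal_univ, smul_eq_mul, mul_one] at hlim
  have hlim2 := hF1.tendsto.comp hlim
  rw [hF.map_one] at hlim2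
  obtain ⟨n, hn⟩ := (hlim2.eventually_lt_const (show (0 : ℝ) < 1 / (4 * C) by positivity)).exists
  exact ⟨_, hpos n, by linarith [hle n], integrable_sobolevInv_of_le hF
    (measurable_truncatedPotential hV) (truncatedPotential_nonneg hC) (hbd n) hFV, hn.le⟩

theorem lambdaOne_mem_Ioc (hF : IsSobolevFunction F) (hC : 0 < C) (hV : Measurable V)
    (hl₀ : 0 < l₀) (hFV : Integrable (fun x => sobolevInv F (l₀ * max (V x) 0)) μ) :
    0 < lambdaOne μ F V C l₀ ∧ lambdaOne μ F V C l₀ ≤ l₀ := by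
  obtain ⟨l, hl⟩ := admissible_nonempty hF hC hV hl₀ hFV
  exact ⟨hl.1.trans_le (le_csSup ⟨l₀, fun _ h => h.2.1⟩ hl), csSup_le ⟨l, hl⟩ fun _ h => h.2.1⟩

theorem admissible_of_lt_lambdaOne (hF : IsSobolevFunction F) (hC : 0 < C) (hV : Measurable V)
    (hl₀ : 0 < l₀) (hFV : Integrable (fun x => sobolevInv F (l₀ * max (V x) 0)) μ) {l : ℝ}
    (hl : 0 < l) (h : l < lambdaOne μ F V C l₀) : l ∈ admissible μ F V C l₀ := by
  obtain ⟨l', hl', hlt⟩ := exists_lt_of_lt_csSup (admissible_nonempty hF hC hV hl₀ hFV) h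
  exact admissible_of_le hF hC hV hl' hl hlt.le

end LambdaOne

/-! ### The rate function -/

section DeviationRate

variable {m C l₁ R : ℝ}

/-- The hypothesis places the vertex `R / (16 m² C)` of the parabola in `[0, l₁]`; it also forces `m
≠ 0`, because `R > 0`. -/
theorem deviationRate_eq_of_le (hC : 0 < C) (hR : 0 < R) (h : R ≤ 16 * m ^ 2 * C * l₁) :
    deviationRate m C l₁ R = R ^ 2 / (32 * m ^ 2 * C) := by
  have hm : 0 < m ^ 2 := by
    rcases (sq_nonneg m).eq_or_lt with h0 | h0
    · rw [← h0] at h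
      simp only [mul_zero, zero_mul] at h
      linarith
    · exact h0
  refine IsGreatest.csSup_eq ⟨⟨R / (16 * m ^ 2 * C), ⟨by positivity, ?_⟩, ?_⟩, ?_⟩
  · rw [div_le_iff₀ (by positivity)]
    linarith
  · simp only
    field_simp
    ring
  · rintro _ ⟨l, -, rfl⟩
    simp only
    rw [le_div_iff₀ (by positivity)]
    nlinarith [sq_nonneg (R - 16 * m ^ 2 * C * l)]

/-- The parabola has not yet passed its vertex, so it increases on `[0, l₁]`. If `m = 0` it is a
line of slope `R ≥ 0`. -/
theorem deviationRate_eq_of_ge (hC : 0 < C) (hl₁ : 0 ≤ l₁) (h : 16 * m ^ 2 * C * l₁ ≤ R) :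
    deviationRate m C l₁ R = l₁ * R - 8 * m ^ 2 * C * l₁ ^ 2 := by
  refine IsGreatest.csSup_eq ⟨⟨l₁, ⟨hl₁, le_rfl⟩, by ring⟩, ?_⟩
  rintro _ ⟨l, hl, rfl⟩
  simp only
  have h0 : 0 ≤ m ^ 2 * C := by positivity
  have h1 : m ^ 2 * C * l ≤ m ^ 2 * C * l₁ := mul_le_mul_of_nonneg_left hl.2 h0
  have h2 : 0 ≤ (l₁ - l) * (R - 8 * (m ^ 2 * C) * (l₁ + l)) :=
    mul_nonneg (sub_nonneg.2 hl.2) (by nlinarith)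
  nlinarith

theorem exists_deviationRate_eq (hl₁ : 0 ≤ l₁) :
    ∃ l ∈ Icc 0 l₁, deviationRate m C l₁ R = R * l - 8 * m ^ 2 * C * l ^ 2 :=
  isCompact_Icc.exists_sSup_image_eq ⟨0, le_rfl, hl₁⟩
    (by fun_prop : Continuous fun l : ℝ => R * l - 8 * m ^ 2 * C * l ^ 2).continuousOn

end DeviationRate

/-! ### Truncation, exponential moments and the deviation bound -/

/-- The truncation of `y` at levels `±n`. -/
def clip (n : ℕ) (y : ℝ) : ℝ := max (min y n) (-n)

theorem clip_le (n : ℕ) (y : ℝ) : clip n y ≤ n :=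
  max_le (min_le_right _ _) (by linarith [(Nat.cast_nonneg n : (0 : ℝ) ≤ n)])

theorem neg_le_clip (n : ℕ) (y : ℝ) : -(n : ℝ) ≤ clip n y := le_max_right _ _

theorem abs_clip_le_nat (n : ℕ) (y : ℝ) : |clip n y| ≤ n := abs_le.2 ⟨neg_le_clip n y, clip_le n y⟩

theorem abs_clip_le (n : ℕ) (y : ℝ) : |clip n y| ≤ |y| := by
  have hn : (0 : ℝ) ≤ n := Nat.cast_nonneg n
  refine abs_le.2 ⟨le_max_of_le_left (le_min (neg_abs_le y) ?_), max_le ?_ ?_⟩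
  · linarith [abs_nonneg y]
  · exact (min_le_left _ _).trans (le_abs_self y)
  · linarith [abs_nonneg y]

theorem clip_le_posPart (n : ℕ) (y : ℝ) : clip n y ≤ max y 0 :=
  max_le_max (min_le_left _ _) (neg_nonpos.2 (Nat.cast_nonneg n))

theorem continuous_clip (n : ℕ) : Continuous (clip n) := by
  unfold clip
  fun_prop

theorem tendsto_clip (y : ℝ) : Tendsto (fun n => clip n y) atTop (𝓝 y) := by
  refine tendsto_const_nhds.congr' ?_
  filter_upwards [eventually_ge_atTop ⌈|y|⌉₊] with n hn
  have h : |y| ≤ n := (Nat.le_ceil _).trans (by exact_mod_cast hn)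
  rw [clip, min_eq_left ((le_abs_self y).trans h), max_eq_left (by linarith [neg_abs_le y])]

theorem lintegral_le_eLpNorm_mul_rnDeriv {E : Type*} [MeasurableSpace E] {μ ν : Measure E}
    [IsProbabilityMeasure μ] [IsProbabilityMeasure ν] (hν : ν ≪ μ) {u : E → ℝ}
    (hu : Measurable u) (hu0 : ∀ x, 0 ≤ u x) :
    ∫⁻ x, ENNReal.ofReal (u x) ∂ν ≤
      eLpNorm (fun x => (ν.rnDeriv μ x).toReal) 2 μ * eLpNorm u 2 μ := by
  rw [← lintegral_rnDeriv_mul hν hu.ennreal_ofReal.aemeasurable]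
  have h := eLpNorm_smul_le_mul_eLpNorm (μ := μ) (p := 2) (q := 2) (r := 1)
    hu.aestronglyMeasurable
    (ν.measurable_rnDeriv μ).ennreal_toReal.aestronglyMeasurable
  rw [eLpNorm_one_eq_lintegral_enorm] at h
  refine le_trans (le_of_eq (lintegral_congr_ae ?_)) h
  filter_upwards [ν.rnDeriv_lt_top μ] with x hx
  rw [Pi.smul_apply', enorm_smul, Real.enorm_eq_ofReal ENNReal.toReal_nonneg,
    Real.enorm_eq_ofReal (hu0 x), ENNReal.ofReal_toReal hx.ne]

namespace MarkovProcess

variable {E Ω : Type*} [MeasurableSpace E] [MeasurableSpace Ω] (M : MarkovProcess E Ω)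

theorem lintegral_lawFrom (ν : Measure E) {f : Ω → ℝ≥0∞} (hf : Measurable f) :
    ∫⁻ ω, f ω ∂M.lawFrom ν = ∫⁻ x, ∫⁻ ω, f ω ∂M.law x ∂ν :=
  Measure.lintegral_bind M.law.measurable.aemeasurable hf.aemeasurable

theorem lintegral_lawFrom_at {μ : Measure E} (hinv : M.IsInvariant μ) (s : ℝ≥0) {f : E → ℝ≥0∞}
    (hf : Measurable f) : ∫⁻ ω, f (M.X s ω) ∂M.lawFrom μ = ∫⁻ x, f x ∂μ := by
  have hfX : Measurable fun ω => f (M.X s ω) := hf.comp (M.measurable_at s)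
  rw [M.lintegral_lawFrom μ hfX]
  simp_rw [← M.lintegral_transition s _ hf]
  rw [← Measure.lintegral_bind (M.transition s).measurable.aemeasurable hf.aemeasurable]
  congr 1
  exact hinv s

theorem measurable_path_uncurry {V : E → ℝ} (hV : Measurable V) :
    Measurable fun p : Ω × ℝ => V (M.X p.2.toNNReal p.1) := by
  simpa using M.measurable_path hV 0

/-- By invariance the `ℙ_μ`-mean of `∫_0^t |V(X_s)| ds` is `t ∫ |V| dμ < ∞`. Finiteness thus holds
`ℙ_x`-almost surely for `μ`-almost every `x`, hence for `ν`-almost every `x`. -/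
theorem ae_intervalIntegrable {μ : Measure E} [IsProbabilityMeasure μ] (hinv : M.IsInvariant μ)
    {V : E → ℝ} (hV : Measurable V) (hVi : Integrable V μ) {ν : Measure E} (hν : ν ≪ μ) {t : ℝ}
    (ht : 0 ≤ t) :
    ∀ᵐ ω ∂M.lawFrom ν, IntervalIntegrable (fun s : ℝ => V (M.X s.toNNReal ω)) volume 0 t := by
  have hVm := M.measurable_path_uncurry hV
  have hm : Measurable fun ω => ∫⁻ s in Ioc 0 t, ‖V (M.X s.toNNReal ω)‖ₑ :=
    hVm.enorm.lintegral_prod_right'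
  have hset : MeasurableSet {ω | ∫⁻ s in Ioc 0 t, ‖V (M.X s.toNNReal ω)‖ₑ < ∞} :=
    measurableSet_lt hm measurable_const
  have hμ : ∀ᵐ ω ∂M.lawFrom μ, ∫⁻ s in Ioc 0 t, ‖V (M.X s.toNNReal ω)‖ₑ < ∞ := by
    have : SFinite (M.lawFrom μ) := inferInstanceAs (SFinite (M.law ∘ₘ μ))
    refine ae_lt_top hm ?_
    rw [lintegral_lintegral_swap hVm.enorm.aemeasurable]
    simp_rw [M.lintegral_lawFrom_at hinv _ hV.enorm]
    rw [lintegral_const, Measure.restrict_apply_univ, Real.volume_Ioc]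
    exact ENNReal.mul_ne_top hVi.2.ne ENNReal.ofReal_ne_top
  have hν' : ∀ᵐ ω ∂M.lawFrom ν, ∫⁻ s in Ioc 0 t, ‖V (M.X s.toNNReal ω)‖ₑ < ∞ :=
    Measure.ae_comp_of_ae_ae hset (hν.ae_le (Measure.ae_ae_of_ae_comp hμ))
  filter_upwards [hν'] with ω hω
  rw [intervalIntegrable_iff_integrableOn_Ioc_of_le ht]
  exact ⟨(hVm.comp measurable_prodMk_left).aestronglyMeasurable, hω⟩

/-- Exponential moments of the additive functional of a bounded potential. -/
theorem lintegral_exp_clip_le {μ : Measure E} [IsProbabilityMeasure μ] (hinv : M.IsInvariant μ)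
    (hcont : M.IsStronglyContinuous μ) {F : ℝ → ℝ} (hF : IsSobolevFunction F)
    (hSob : M.FSobolev μ F) {C : ℝ} (hC : 0 < C) (hPoinc : M.Poincare μ C) {V : E → ℝ}
    (hV : Measurable V) (hV2 : MemLp V 2 μ) {l₀ l : ℝ} (hl : l ∈ admissible μ F V C l₀)
    {ν : Measure E} [IsProbabilityMeasure ν] (hν : ν ≪ μ) {t : ℝ} (ht : 0 ≤ t) (n : ℕ) :
    ∫⁻ ω, ENNReal.ofReal (Real.exp (l * ∫ s in (0 : ℝ)..t, clip n (V (M.X s.toNNReal ω))))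
        ∂M.lawFrom ν ≤
      eLpNorm (fun x => (ν.rnDeriv μ x).toReal) 2 μ *
        ENNReal.ofReal (Real.exp
          ((8 * C * (l ^ 2 * ∫ x, V x ^ 2 ∂μ) + |l * ∫ x, clip n (V x) ∂μ|) * t)) := by
  have hl0 := hl.1
  obtain ⟨Vn, hVn⟩ : ∃ Vn : E → ℝ, Vn = fun x => clip n (V x) := ⟨_, rfl⟩
  have hVnm : Measurable Vn := hVn ▸ (continuous_clip n).measurable.comp hV
  have hVnb : ∀ x, |Vn x| ≤ n := fun x => hVn ▸ abs_clip_le_nat n (V x)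
  have hVn' : ∀ x, clip n (V x) = Vn x := fun x => by rw [hVn]
  simp_rw [hVn']
  -- The shift by `l n` makes the potential nonnegative; it multiplies the exponential by `exp(l n
  -- t)`, which is divided out at the end. The extra `1` in the bound `2 l n + 1` serves only the
  -- requirement `1 ≤ K`.
  obtain ⟨W, hWdef⟩ : ∃ W : E → ℝ, W = fun x => l * Vn x + l * n := ⟨_, rfl⟩
  have hW : IsBoundedPotential W (2 * l * n + 1) := by
    refine ⟨hWdef ▸ (hVnm.const_mul l).add_const _, fun x => ?_, fun x => ?_, ?_⟩
    · have := mul_le_mul_of_nonneg_left (abs_le.1 (hVnb x)).1 hl0.le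
      rw [hWdef]; simp only; linarith
    · have := mul_le_mul_of_nonneg_left (abs_le.1 (hVnb x)).2 hl0.le
      rw [hWdef]; simp only; linarith
    · have : 0 ≤ 2 * l * n := by positivity
      linarith
  obtain ⟨q, hq⟩ : ∃ q, q = l ^ 2 * ∫ x, V x ^ 2 ∂μ := ⟨_, rfl⟩
  have hform : ∀ f g : E → ℝ, Measurable f → (∃ D, ∀ x, |f x| ≤ D) → M.GeneratorGraph μ f g →
      ∫ x, W x * f x ^ 2 ∂μ + ∫ x, g x * f x ∂μ ≤
        ((8 * C * q + |l * ∫ x, Vn x ∂μ|) + l * n) * ∫ x, f x ^ 2 ∂μ := by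
    intro f g hf hfb hfg
    have hBm : Measurable fun x => l * Vn x := hVnm.const_mul l
    have hBb : ∀ x, |l * Vn x| ≤ l * n := fun x => by
      rw [abs_mul, abs_of_pos hl0]
      exact mul_le_mul_of_nonneg_left (hVnb x) hl0.le
    have hBq : ∫ x, (l * Vn x) ^ 2 ∂μ ≤ q := by
      simp_rw [mul_pow]
      rw [integral_const_mul, hq]
      refine mul_le_mul_of_nonneg_left ?_ (sq_nonneg l)
      refine integral_mono_of_nonneg (ae_of_all _ fun x => sq_nonneg _) hV2.integrable_sq
        (ae_of_all _ fun x => ?_)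
      exact sq_le_sq.2 (hVn ▸ abs_clip_le n (V x))
    have h := form_le hinv hF hSob hC hPoinc hBm hBb hBq (truncatedPotential_nonneg hC)
      hl.2.2.1 hl.2.2.2 (fun x => (mul_le_mul_of_nonneg_left
        (hVn ▸ clip_le_posPart n (V x) : Vn x ≤ max (V x) 0) hl0.le).trans
        (mul_posPart_le_truncatedPotential hC x)) hf hfb hfg
    rw [integral_const_mul] at h
    obtain ⟨D, hD⟩ := hfb
    have hf2 : Integrable (fun x => f x ^ 2) μ :=
      integrable_of_bounded (hf.pow_const 2) (C := D ^ 2) fun x => by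
        rw [abs_pow]; exact pow_le_pow_left₀ (abs_nonneg _) (hD x) 2
    have e : ∫ x, W x * f x ^ 2 ∂μ = ∫ x, l * Vn x * f x ^ 2 ∂μ + l * n * ∫ x, f x ^ 2 ∂μ := by
      rw [← integral_const_mul, ← integral_add (hf2.bdd_mul hBm.aestronglyMeasurable
        (ae_of_all _ hBb)) (hf2.const_mul _), hWdef]
      refine integral_congr_ae (ae_of_all _ fun x => ?_)
      simp only
      ring
    rw [e, add_mul]
    linarith
  have hfk := M.integral_feynmanKac_sq_le hcont hW hform ht
  obtain ⟨Θ, hΘ⟩ : ∃ Θ, Θ = 8 * C * q + |l * ∫ x, Vn x ∂μ| := ⟨_, rfl⟩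
  rw [← hΘ] at hfk
  rw [← hq, ← hΘ]
  have hum := M.measurable_feynmanKac hW.measurable t
  have hnorm : eLpNorm (M.feynmanKac W t) 2 μ ≤ ENNReal.ofReal (Real.exp ((Θ + l * n) * t)) := by
    refine (ENNReal.pow_le_pow_left_iff two_ne_zero).1 ?_
    rw [eLpNorm_two_sq, ← ENNReal.ofReal_pow (Real.exp_nonneg _), ← Real.exp_nat_mul]
    have e : ∀ x, ‖M.feynmanKac W t x‖ₑ ^ 2 = ENNReal.ofReal (M.feynmanKac W t x ^ 2) := fun x => by
      rw [Real.enorm_eq_ofReal (M.feynmanKac_nonneg W t x),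
        ENNReal.ofReal_pow (M.feynmanKac_nonneg W t x)]
    simp_rw [e]
    rw [← ofReal_integral_eq_lintegral_ofReal (integrable_of_bounded (hum.pow_const 2)
      (C := Real.exp ((2 * l * n + 1) * t) ^ 2) fun x => ?_) (ae_of_all _ fun x => sq_nonneg _)]
    · refine ENNReal.ofReal_le_ofReal (hfk.trans (le_of_eq ?_))
      congr 1
      push_cast
      ring
    · rw [abs_pow]
      exact pow_le_pow_left₀ (abs_nonneg _) (M.abs_feynmanKac_le hW le_rfl ht x) 2
  have hpath : ∀ ω, Real.exp (l * ∫ s in (0 : ℝ)..t, Vn (M.X s.toNNReal ω)) =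
      Real.exp (-(l * n * t)) * Real.exp (M.pathIntegral W 0 t ω) := by
    intro ω
    have hint : IntervalIntegrable (fun s : ℝ => Vn (M.X s.toNNReal ω)) volume 0 t :=
      intervalIntegrable_of_bounded ((M.measurable_path_uncurry hVnm).comp measurable_prodMk_left)
        fun r _ => hVnb _
    have e : M.pathIntegral W 0 t ω =
        l * (∫ s in (0 : ℝ)..t, Vn (M.X s.toNNReal ω)) + l * n * t := by
      rw [pathIntegral, hWdef]
      simp only [zero_add]
      rw [intervalIntegral.integral_add (hint.const_mul l) intervalIntegrable_const,
        intervalIntegral.integral_const_mul, intervalIntegral.integral_const]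
      simp
      ring
    rw [← Real.exp_add, e]
    congr 1
    ring
  have hexpm := M.measurable_exp_pathIntegral hW.measurable 0 t
  simp_rw [hpath, ENNReal.ofReal_mul (Real.exp_nonneg _)]
  rw [lintegral_const_mul _ hexpm.ennreal_ofReal, M.lintegral_lawFrom ν hexpm.ennreal_ofReal]
  have e1 : ∀ x, ∫⁻ ω, ENNReal.ofReal (Real.exp (M.pathIntegral W 0 t ω)) ∂M.law x =
      ENNReal.ofReal (M.feynmanKac W t x) := fun x =>
    (ofReal_integral_eq_lintegral_ofReal (M.integrable_exp_pathIntegral hW 0 t x)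
      (ae_of_all _ fun _ => Real.exp_nonneg _)).symm
  simp_rw [e1]
  calc _ ≤ ENNReal.ofReal (Real.exp (-(l * n * t))) *
        (eLpNorm (fun x => (ν.rnDeriv μ x).toReal) 2 μ *
          ENNReal.ofReal (Real.exp ((Θ + l * n) * t))) := by
        gcongr
        exact (lintegral_le_eLpNorm_mul_rnDeriv hν hum (M.feynmanKac_nonneg W t)).trans
          (by gcongr)
    _ = eLpNorm (fun x => (ν.rnDeriv μ x).toReal) 2 μ *
          (ENNReal.ofReal (Real.exp (-(l * n * t))) *
            ENNReal.ofReal (Real.exp ((Θ + l * n) * t))) := by ring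
    _ = _ := by
        rw [← ENNReal.ofReal_mul (Real.exp_nonneg _), ← Real.exp_add]
        congr 3
        ring

/-- Fatou's lemma along the truncations. Their means need not vanish but tend to `∫ V dμ = 0`, so
the correction in the exponent disappears in the limit. -/
theorem lintegral_exp_le {μ : Measure E} [IsProbabilityMeasure μ] (hinv : M.IsInvariant μ)
    (hcont : M.IsStronglyContinuous μ) {F : ℝ → ℝ} (hF : IsSobolevFunction F)
    (hSob : M.FSobolev μ F) {C : ℝ} (hC : 0 < C) (hPoinc : M.Poincare μ C) {V : E → ℝ}
    (hV : Measurable V) (hV2 : MemLp V 2 μ) (hV0 : ∫ x, V x ∂μ = 0) {l₀ l : ℝ}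
    (hl : l ∈ admissible μ F V C l₀) {ν : Measure E} [IsProbabilityMeasure ν] (hν : ν ≪ μ)
    {t : ℝ} (ht : 0 ≤ t) :
    ∫⁻ ω, ENNReal.ofReal (Real.exp (l * ∫ s in (0 : ℝ)..t, V (M.X s.toNNReal ω))) ∂M.lawFrom ν ≤
      eLpNorm (fun x => (ν.rnDeriv μ x).toReal) 2 μ *
        ENNReal.ofReal (Real.exp (8 * C * (l ^ 2 * ∫ x, V x ^ 2 ∂μ) * t)) := by
  have hVi : Integrable V μ := hV2.integrable one_le_two
  have hcm : ∀ n : ℕ, Measurable fun x => clip n (V x) := fun n =>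
    (continuous_clip n).measurable.comp hV
  have hcontexp : ∀ c : ℝ, Continuous fun y : ℝ => ENNReal.ofReal (Real.exp (c * y)) := fun c =>
    ENNReal.continuous_ofReal.comp (by fun_prop)
  have hpath : ∀ᵐ ω ∂M.lawFrom ν, ENNReal.ofReal (Real.exp
      (l * ∫ s in (0 : ℝ)..t, V (M.X s.toNNReal ω))) =
      liminf (fun n => ENNReal.ofReal (Real.exp
        (l * ∫ s in (0 : ℝ)..t, clip n (V (M.X s.toNNReal ω))))) atTop := by
    filter_upwards [M.ae_intervalIntegrable hinv hV hVi hν ht] with ω hω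
    have h1 : Tendsto (fun n => ∫ s in (0 : ℝ)..t, clip n (V (M.X s.toNNReal ω))) atTop
        (𝓝 (∫ s in (0 : ℝ)..t, V (M.X s.toNNReal ω))) := by
      refine intervalIntegral.tendsto_integral_filter_of_dominated_convergence
        (fun s => |V (M.X s.toNNReal ω)|) (Eventually.of_forall fun n => ?_)
        (Eventually.of_forall fun n => ae_of_all _ fun s _ => abs_clip_le n _) hω.abs
        (ae_of_all _ fun s _ => tendsto_clip _)
      exact ((M.measurable_path_uncurry (hcm n)).comp measurable_prodMk_left).aestronglyMeasurable
    exact (((hcontexp l).tendsto _).comp h1).liminf_eq.symm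
  have hmean : Tendsto (fun n => ∫ x, clip n (V x) ∂μ) atTop (𝓝 0) := by
    rw [← hV0]
    exact tendsto_integral_of_dominated_convergence (fun x => |V x|)
      (fun n => (hcm n).aestronglyMeasurable) hVi.abs
      (fun n => ae_of_all _ fun x => abs_clip_le n _) (ae_of_all _ fun x => tendsto_clip _)
  have hlim : Tendsto (fun n => eLpNorm (fun x => (ν.rnDeriv μ x).toReal) 2 μ *
      ENNReal.ofReal (Real.exp
        ((8 * C * (l ^ 2 * ∫ x, V x ^ 2 ∂μ) + |l * ∫ x, clip n (V x) ∂μ|) * t))) atTop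
      (𝓝 (eLpNorm (fun x => (ν.rnDeriv μ x).toReal) 2 μ *
        ENNReal.ofReal (Real.exp (8 * C * (l ^ 2 * ∫ x, V x ^ 2 ∂μ) * t)))) := by
    -- The norm of the density may be `+∞`, so continuity of the product relies on the other limit
    -- being nonzero.
    refine ENNReal.Tendsto.const_mul ?_ (Or.inl (ENNReal.ofReal_pos.2 (Real.exp_pos _)).ne')
    have hc : Continuous fun y : ℝ => ENNReal.ofReal (Real.exp
        ((8 * C * (l ^ 2 * ∫ x, V x ^ 2 ∂μ) + |l * y|) * t)) :=
      ENNReal.continuous_ofReal.comp (by fun_prop)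
    have h := (hc.tendsto 0).comp hmean
    simpa [Function.comp_def] using h
  rw [lintegral_congr_ae hpath]
  refine (lintegral_liminf_le fun n => ?_).trans ?_
  · exact (((measurable_intervalIntegral (f := fun ω s => clip n (V (M.X s.toNNReal ω)))
      (M.measurable_path_uncurry (hcm n)) 0 t).const_mul l).exp).ennreal_ofReal
  · rw [← hlim.liminf_eq]
    exact liminf_le_liminf (Eventually.of_forall fun n =>
      M.lintegral_exp_clip_le hinv hcont hF hSob hC hPoinc hV hV2 hl hν ht n)

theorem lawFrom_deviation_le {μ : Measure E} [IsProbabilityMeasure μ] (hinv : M.IsInvariant μ)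
    (hcont : M.IsStronglyContinuous μ) {F : ℝ → ℝ} (hF : IsSobolevFunction F)
    (hSob : M.FSobolev μ F) {C : ℝ} (hC : 0 < C) (hPoinc : M.Poincare μ C) {V : E → ℝ}
    (hV : Measurable V) (hV2 : MemLp V 2 μ) (hV0 : ∫ x, V x ∂μ = 0) {m : ℝ}
    (hm : ∫ x, V x ^ 2 ∂μ = m ^ 2) {l₀ l : ℝ} (hl : l ∈ admissible μ F V C l₀)
    {ν : Measure E} [IsProbabilityMeasure ν] (hν : ν ≪ μ) {t : ℝ} (ht : 0 < t) (R : ℝ) :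
    M.lawFrom ν {ω | R ≤ (1 / t) * ∫ s in (0 : ℝ)..t, V (M.X s.toNNReal ω)} ≤
      eLpNorm (fun x => (ν.rnDeriv μ x).toReal) 2 μ *
        ENNReal.ofReal (Real.exp (-t * (R * l - 8 * m ^ 2 * C * l ^ 2))) := by
  have hAm : Measurable fun ω => ENNReal.ofReal (Real.exp
      (l * ∫ s in (0 : ℝ)..t, V (M.X s.toNNReal ω))) :=
    (((measurable_intervalIntegral (f := fun ω s => V (M.X s.toNNReal ω))
      (M.measurable_path_uncurry hV) 0 t).const_mul l).exp).ennreal_ofReal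
  have hc0 : 0 < Real.exp (l * (R * t)) := Real.exp_pos _
  calc _ ≤ M.lawFrom ν {ω | ENNReal.ofReal (Real.exp (l * (R * t))) ≤
        ENNReal.ofReal (Real.exp (l * ∫ s in (0 : ℝ)..t, V (M.X s.toNNReal ω)))} := by
        refine measure_mono fun ω (hω : R ≤ _) => ?_
        rw [one_div, ← div_eq_inv_mul, le_div_iff₀ ht] at hω
        exact ENNReal.ofReal_le_ofReal (Real.exp_le_exp.2
          (mul_le_mul_of_nonneg_left hω hl.1.le))
    _ ≤ (∫⁻ ω, ENNReal.ofReal (Real.exp (l * ∫ s in (0 : ℝ)..t, V (M.X s.toNNReal ω)))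
          ∂M.lawFrom ν) / ENNReal.ofReal (Real.exp (l * (R * t))) :=
        meas_ge_le_lintegral_div hAm.aemeasurable (ENNReal.ofReal_pos.2 hc0).ne'
          ENNReal.ofReal_ne_top
    _ ≤ (eLpNorm (fun x => (ν.rnDeriv μ x).toReal) 2 μ *
          ENNReal.ofReal (Real.exp (8 * C * (l ^ 2 * ∫ x, V x ^ 2 ∂μ) * t))) /
          ENNReal.ofReal (Real.exp (l * (R * t))) := by
        gcongr
        exact M.lintegral_exp_le hinv hcont hF hSob hC hPoinc hV hV2 hV0 hl hν ht.le
    _ = _ := by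
        rw [mul_div_assoc, ← ENNReal.ofReal_div_of_pos hc0, ← Real.exp_sub, hm]
        congr 3
        ring

end MarkovProcess

end

theorem mainTheorem3 {E Ω : Type*} [TopologicalSpace E] [PolishSpace E] [MeasurableSpace E]
    [BorelSpace E] [MeasurableSpace Ω] (M : MarkovProcess E Ω)
    (μ : Measure E) [IsProbabilityMeasure μ]
    (hinv : M.IsInvariant μ) (hcont : M.IsStronglyContinuous μ)
    (F : ℝ → ℝ) (hF : IsSobolevFunction F) (hSob : M.FSobolev μ F)
    (C_P : ℝ) (hC : 0 < C_P) (hPoinc : M.Poincare μ C_P)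
    (V : E → ℝ) (hVmeas : Measurable V) (hV2 : MemLp V 2 μ) (hV0 : ∫ x, V x ∂μ = 0)
    (m : ℝ) (hm : ∫ x, V x ^ 2 ∂μ = m ^ 2)
    (l₀ : ℝ) (hl₀ : 0 < l₀) (hFV : Integrable (fun x => sobolevInv F (l₀ * max (V x) 0)) μ) :
    (0 < lambdaOne μ F V C_P l₀ ∧ lambdaOne μ F V C_P l₀ ≤ l₀) ∧
    (∀ (ν : Measure E) [IsProbabilityMeasure ν], ν ≪ μ → ∀ t : ℝ, 0 < t →
      (∀ᵐ ω ∂(M.lawFrom ν),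
        IntervalIntegrable (fun s : ℝ => V (M.X s.toNNReal ω)) volume 0 t) ∧
      ∀ R : ℝ, 0 < R →
        M.lawFrom ν {ω | R ≤ (1 / t) * ∫ s in (0 : ℝ)..t, V (M.X s.toNNReal ω)} ≤
          eLpNorm (fun x => (ν.rnDeriv μ x).toReal) 2 μ *
            ENNReal.ofReal
              (Real.exp (-t * deviationRate m C_P (lambdaOne μ F V C_P l₀) R))) ∧
    (∀ R : ℝ, 0 < R →
      (R ≤ 16 * m ^ 2 * C_P * lambdaOne μ F V C_P l₀ →
        deviationRate m C_P (lambdaOne μ F V C_P l₀) R = R ^ 2 / (32 * m ^ 2 * C_P)) ∧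
      (16 * m ^ 2 * C_P * lambdaOne μ F V C_P l₀ ≤ R →
        deviationRate m C_P (lambdaOne μ F V C_P l₀) R =
          lambdaOne μ F V C_P l₀ * R - 8 * m ^ 2 * C_P * lambdaOne μ F V C_P l₀ ^ 2)) := by
  have hl₁ := lambdaOne_mem_Ioc hF hC hVmeas hl₀ hFV
  refine ⟨hl₁, fun ν _ hν t ht => ⟨M.ae_intervalIntegrable hinv hVmeas
    (hV2.integrable one_le_two) hν ht.le, fun R _ => ?_⟩, fun R hR =>
    ⟨deviationRate_eq_of_le hC hR, deviationRate_eq_of_ge hC hl₁.1.le⟩⟩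
  obtain ⟨l, hl, hrate⟩ := exists_deviationRate_eq (m := m) (C := C_P) (R := R) hl₁.1.le
  rw [hrate]
  -- The maximiser `l` may be an endpoint `0` or `λ₁`, where admissibility is not at hand. The bound
  -- holds on the open interval and is continuous in `l`, so it passes to the closure.
  have hne : (𝓝[Ioo 0 (lambdaOne μ F V C_P l₀)] l).NeBot := by
    rw [← mem_closure_iff_nhdsWithin_neBot, closure_Ioo hl₁.1.ne]
    exact hl
  have hc : Continuous fun l : ℝ => ENNReal.ofReal
      (Real.exp (-t * (R * l - 8 * m ^ 2 * C_P * l ^ 2))) :=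
    ENNReal.continuous_ofReal.comp (by fun_prop)
  refine ge_of_tendsto (ENNReal.Tendsto.const_mul ((hc.tendsto l).mono_left
    (nhdsWithin_le_nhds (s := Ioo 0 (lambdaOne μ F V C_P l₀))))
    (Or.inl (ENNReal.ofReal_pos.2 (Real.exp_pos _)).ne')) ?_
  filter_upwards [self_mem_nhdsWithin] with l' hl'
  exact M.lawFrom_deviation_le hinv hcont hF hSob hC hPoinc hVmeas hV2 hV0 hm
    (admissible_of_lt_lambdaOne hF hC hVmeas hl₀ hFV hl'.1 hl'.2) hν ht R
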